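/- Let $\mathcal H$ be a complex Hilbert space (possibly infinite-dimensional), $d\in\mathbb N$, $\rho$ a density operator on $\mathcal H$ (positive semidefinite, trace class, $\mathrm{Tr}\,\rho=1$), $D_1,\dots,D_d$ linearly independent self-adjoint trace-class operators on $\mathcal H$, and $G$ a real symmetric positive semidefinite $d\times d$ matrix. Let $\mathcal R=\mathbb R^{d+1}$ with basis $|0\rangle,\dots,|d\rangle$ and $\mathcal R_C=\mathbb C^{d+1}$; regard $G$ as $\sum_{i,j=1}^dG_{i,j}|i\rangle\langle j|$. Let $\mathcal B$ (resp. $\mathcal T$) be the set of operators $\sum_{k,j=0}^d|k\rangle\langle j|\otimes X^{k,j}$ with $X^{k,j}=X^{j,k}$ bounded (resp. trace-class) self-adjoint operators on $\mathcal H$; let $\mathcal B''$ be the set of operators $\sum_{k,j}|k\rangle\langle j|\otimes X^{k,j}$ with $X^{k,j}$ bounded, $X^{k,j}=(X^{j,k})^\dagger$ and $X^{k,0}$ self-adjoint; and let $\mathcal B''_\rho$ be the set of $X\in\mathcal B''$ with $\mathrm{Tr}[X((|j\rangle\langle i|-|i\rangle\langle j|)\otimes\rho)]=0$ for $1\le i,j\le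 d$. Define the cones - $K_1$: the convex hull of $\{T\otimes M : T$ a real symmetric positive semidefinite matrix on $\mathcal R$, $M$ a bounded positive semidefinite operator on $\mathcal H\}$; - $K_2$: the positive semidefinite elements of $\mathcal B$; - $K_3$: the positive semidefinite elements of $\mathcal B''$ whose partial transpose on $\mathcal R_C$ is also positive semidefinite; - $K_4$: the positive semidefinite elements of $\mathcal B''$; - $K_5$: the positive semidefinite elements of $\mathcal B''_\rho$. For $l=1,\dots,5$ let $S(Pl)$ be the infimum of $\mathrm{Tr}[(G\otimes\rho)X]$ over all $X\in K_l$ with $\mathrm{Tr}_{\mathcal R}[(|0\rangle\langle0|\otimes I)X]=I$ and $\mathrm{Tr}[(\tfrac12(|0\rangle\langle i|+|i\rangle\langle0|)\otimes D_j)X]=\delta_{i,j}$ for $1\le i,j\le d$. For a real $d\times d$ matrix $a=(a_i^j)$ and a self-adjoint trace-class operator $S$ on $\mathcal H$ put $$\Pi(a,S)=G\otimes\rho-\tfrac12\sum_{i,j=1}^da_i^j(|0\rangle\langle i|+|i\rangle\langle0|)\otimes D_j-|0\rangle\langle0|\otimes S ,$$ and let $S(Dl)$ be the supremum of $\sum_ia_i^i+\mathrm{Tr}\,S$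 over all such $(a,S)$ with $\Pi(a,S)\in K_l^*:=\{W\in\mathcal T:\mathrm{Tr}[WY]\ge0\text{ for all }Y\in K_l\}$. Then, for every $l=1,\dots,5$, both values are finite and $S(Pl)=S(Dl)$. -/

import Mathlib

noncomputable section

namespace CRBound

variable {H : Type*} [NormedAddCommGroup H] [InnerProductSpace ℂ H] [CompleteSpace H]

/-- A fixed Hilbert basis of `H`, used to compute traces. Neither the notion of trace-class operator
nor the trace of a trace-class operator depends on this choice. -/
def basis (H : Type*) [NormedAddCommGroup H] [InnerProductSpace ℂ H] [CompleteSpace H] :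
    HilbertBasis (exists_hilbertBasis ℂ H).choose ℂ H :=
  (exists_hilbertBasis ℂ H).choose_spec.choose

/-- `T` is trace class: `∑ i, ⟨e i, |T| e i⟩ < ∞`, where `|T| = √(T† T)`. -/
def IsTraceClass (T : H →L[ℂ] H) : Prop :=
  Summable fun i => (inner ℂ (basis H i) (CFC.abs T (basis H i))).re

/-- The trace `∑ i, ⟨e i, T e i⟩` of a trace-class operator on `H`. -/
def opTrace (T : H →L[ℂ] H) : ℂ :=
  ∑' i, inner ℂ (basis H i) (T (basis H i))

/-- Bounded operators on `ℛ_C ⊗ H`, where `ℛ_C` has the basis `|0⟩, …, |d⟩`: the matrix `X` stands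
for `∑ k j, |k⟩⟨j| ⊗ X k j`. The product and the adjoint of operators are the product and the
conjugate transpose of matrices, the partial trace over `ℛ_C` is `Matrix.trace`, and the partial
transpose on `ℛ_C` is `Matrix.transpose`. -/
abbrev BlockOp (d : ℕ) (H : Type*) [NormedAddCommGroup H] [InnerProductSpace ℂ H] : Type _ :=
  Matrix (Fin (d + 1)) (Fin (d + 1)) (H →L[ℂ] H)

variable {d : ℕ}

/-- The tensor product `T ⊗ M` of a real matrix and an operator on `H`. -/
def tens (T : Matrix (Fin (d + 1)) (Fin (d + 1)) ℝ) (M : H →L[ℂ] H) : BlockOp d H :=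
  Matrix.of fun k j => T k j • M

/-- The trace over `ℛ_C ⊗ H`: the trace over `H` of the partial trace over `ℛ_C`. -/
def blockTrace (X : BlockOp d H) : ℂ := opTrace (Matrix.trace X)

/-- `ℬ = ℳ_rs(ℛ) ⊗ ℬ_sa(H)`. -/
def spaceB (d : ℕ) (H : Type*) [NormedAddCommGroup H] [InnerProductSpace ℂ H] [CompleteSpace H] :
    Set (BlockOp d H) :=
  {X | ∀ k j, IsSelfAdjoint (X k j) ∧ X k j = X j k}

/-- `𝒯 = ℳ_rs(ℛ) ⊗ 𝒯_sa(H)`. -/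
def spaceT (d : ℕ) (H : Type*) [NormedAddCommGroup H] [InnerProductSpace ℂ H] [CompleteSpace H] :
    Set (BlockOp d H) :=
  {X | ∀ k j, IsSelfAdjoint (X k j) ∧ IsTraceClass (X k j) ∧ X k j = X j k}

/-- `ℬ''`: self-adjoint operators on `ℛ_C ⊗ H` whose blocks `X k 0` are self-adjoint. -/
def spaceB'' (d : ℕ) (H : Type*) [NormedAddCommGroup H] [InnerProductSpace ℂ H] [CompleteSpace H] :
    Set (BlockOp d H) :=
  {X | (∀ k, IsSelfAdjoint (X k 0)) ∧ ∀ k j, X k j = star (X j k)}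

/-- `|j⟩⟨i| - |i⟩⟨j|`, for `i`, `j` among `1, …, d`. -/
def antisymUnit (i j : Fin d) : Matrix (Fin (d + 1)) (Fin (d + 1)) ℝ :=
  Matrix.single j.succ i.succ 1 - Matrix.single i.succ j.succ 1

/-- `(|0⟩⟨i| + |i⟩⟨0|) / 2`, for `i` among `1, …, d`. -/
def symUnit (i : Fin d) : Matrix (Fin (d + 1)) (Fin (d + 1)) ℝ :=
  (1 / 2 : ℝ) • (Matrix.single 0 i.succ 1 + Matrix.single i.succ 0 1)

/-- `ℬ''_ρ`: the elements `X` of `ℬ''` with `Tr [X ((|j⟩⟨i| - |i⟩⟨j|) ⊗ ρ)] = 0` for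
`1 ≤ i, j ≤ d`. -/
def spaceBρ'' (ρ : H →L[ℂ] H) : Set (BlockOp d H) :=
  {X | X ∈ spaceB'' d H ∧ ∀ i j : Fin d, blockTrace (X * tens (antisymUnit i j) ρ) = 0}

/-- `⟨v| X |v⟩` for a vector `v = ∑ k, |k⟩ ⊗ v k` of `ℛ_C ⊗ H`. -/
def quadForm (X : BlockOp d H) (v : Fin (d + 1) → H) : ℂ :=
  ∑ k, ∑ j, inner ℂ (v k) (X k j (v j))

/-- Positive semidefinite self-adjoint operators on `ℛ_C ⊗ H`. (The quadratic form of a self-adjoint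
operator is real.) -/
def posCone (d : ℕ) (H : Type*) [NormedAddCommGroup H] [InnerProductSpace ℂ H] [CompleteSpace H] :
    Set (BlockOp d H) :=
  {X | X.IsHermitian ∧ ∀ v, 0 ≤ (quadForm X v).re}

/-- Positive semidefinite self-adjoint operators on `ℛ_C ⊗ H` with positive semidefinite partial
transpose. -/
def pptCone (d : ℕ) (H : Type*) [NormedAddCommGroup H] [InnerProductSpace ℂ H] [CompleteSpace H] :
    Set (BlockOp d H) :=
  {X | X ∈ posCone d H ∧ X.transpose ∈ posCone d H}

/-- `𝒮_SEP`: the convex hull of the products `T ⊗ M` of a positive semidefinite real symmetric matrix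
and a bounded positive semidefinite operator. -/
def sepCone (d : ℕ) (H : Type*) [NormedAddCommGroup H] [InnerProductSpace ℂ H] [CompleteSpace H] :
    Set (BlockOp d H) :=
  convexHull ℝ {X | ∃ (T : Matrix (Fin (d + 1)) (Fin (d + 1)) ℝ) (M : H →L[ℂ] H),
    T.PosSemidef ∧ M.IsPositive ∧ X = tens T M}

/-- The cones of the five programs, in order:
`𝒮_SEP`, `𝒮_P`, `𝒮(ℛ_C ⊗ H)_PPT ∩ ℬ''`, `𝒮(ℛ_C ⊗ H)_P ∩ ℬ''`, `𝒮(ℛ_C ⊗ H)_P ∩ ℬ''_ρ`. -/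
def cone (d : ℕ) (ρ : H →L[ℂ] H) : Fin 5 → Set (BlockOp d H) :=
  ![sepCone d H, posCone d H ∩ spaceB d H, pptCone d H ∩ spaceB'' d H,
    posCone d H ∩ spaceB'' d H, posCone d H ∩ spaceBρ'' ρ]

/-- The dual cone `{W ∈ 𝒯 | Tr W Y ≥ 0 for all Y ∈ K}`, for a set `K` of self-adjoint operators
(`Tr W Y` is then real). -/
def dualCone (K : Set (BlockOp d H)) : Set (BlockOp d H) :=
  {W | W ∈ spaceT d H ∧ ∀ Y ∈ K, 0 ≤ (blockTrace (W * Y)).re}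

/-- The `d × d` weight matrix as a matrix on `ℛ`, with zero row and column at the index `0`. -/
def extend (G : Matrix (Fin d) (Fin d) ℝ) : Matrix (Fin (d + 1)) (Fin (d + 1)) ℝ :=
  ∑ i, ∑ j, Matrix.single i.succ j.succ (G i j)

/-- The feasible points of the primal program with cone `K`. -/
def primalFeasible (D : Fin d → H →L[ℂ] H) (K : Set (BlockOp d H)) : Set (BlockOp d H) :=
  {X | X ∈ K ∧ Matrix.trace (tens (Matrix.single 0 0 1) 1 * X) = 1 ∧
    ∀ i j, blockTrace (tens (symUnit i) (D j) * X) = if i = j then 1 else 0}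

/-- The optimal value of the primal program: the infimum of `Tr [(G ⊗ ρ) X]`. -/
def primalValue (G : Matrix (Fin d) (Fin d) ℝ) (ρ : H →L[ℂ] H) (D : Fin d → H →L[ℂ] H)
    (K : Set (BlockOp d H)) : EReal :=
  ⨅ X ∈ primalFeasible D K, ((blockTrace (tens (extend G) ρ * X)).re : EReal)

/-- `Π(a, S) = G ⊗ ρ - ∑ i j, a i j (|0⟩⟨i| + |i⟩⟨0|) / 2 ⊗ D j - |0⟩⟨0| ⊗ S`. -/
def dualOp (G : Matrix (Fin d) (Fin d) ℝ) (ρ : H →L[ℂ] H) (D : Fin d → H →L[ℂ] H)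
    (a : Matrix (Fin d) (Fin d) ℝ) (S : H →L[ℂ] H) : BlockOp d H :=
  tens (extend G) ρ - ∑ i, ∑ j, a i j • tens (symUnit i) (D j) - tens (Matrix.single 0 0 1) S

/-- The feasible points of the dual program with cone `K`. -/
def dualFeasible (G : Matrix (Fin d) (Fin d) ℝ) (ρ : H →L[ℂ] H) (D : Fin d → H →L[ℂ] H)
    (K : Set (BlockOp d H)) : Set (Matrix (Fin d) (Fin d) ℝ × (H →L[ℂ] H)) :=
  {p | IsSelfAdjoint p.2 ∧ IsTraceClass p.2 ∧ dualOp G ρ D p.1 p.2 ∈ dualCone K}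

/-- The optimal value of the dual program: the supremum of `Tr a + Tr S`. -/
def dualValue (G : Matrix (Fin d) (Fin d) ℝ) (ρ : H →L[ℂ] H) (D : Fin d → H →L[ℂ] H)
    (K : Set (BlockOp d H)) : EReal :=
  ⨆ p ∈ dualFeasible G ρ D K, ((p.1.trace + (opTrace p.2).re : ℝ) : EReal)

end CRBound

end

noncomputable section

namespace CRBound

variable {H : Type*} [NormedAddCommGroup H] [InnerProductSpace ℂ H] [CompleteSpace H] {ι : Type*}
  {d : ℕ}

set_option linter.unusedSectionVars false

open InnerProductSpace Filter Topology

/-! Weak duality is the evaluation of `Re Tr[Π(a,S) X]` at feasible points. The converse combines a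
purely algebraic separation argument with the replacement of its multiplier by a trace-class
operator.

Separation (`exists_dual_functional`). The constraints form a real linear map `A` from block
operators to `E`, the product of the real `d × d` matrices and the self-adjoint operators. Linear
independence of the `D j` makes the vectors of traces against them arbitrary
(`exists_dual_operators`). Products `T ⊗ M`, which lie in all five cones, then realise every
right-hand side after adding a multiple of `(1, 1)` (`exists_mem_of_constraints`). So `(1, 1)` is an
algebraic interior point of the image of each cone. M. Riesz extension gives a linear functional on
`E`, without any topology, whose value at `(1, 1)` is the primal value. Its matrix component is `a`.
Its operator component `φ` need not be given by a trace-class operator.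

Normal part (`exists_normal_part`, `exists_normal_multiplier`). Testing on `|0⟩⟨0| ⊗ M` shows that
`-φ` is positive. On rank-one operators it is therefore represented by a positive trace-class `T`
with `Tr T ≤ -φ(1)`. Any singular part is discarded, and discarding it can only help: `S = -T` has
`Tr S ≥ φ(1)`. Dual feasibility survives because the inequality for `φ` is used only on compressions
`(1 ⊗ P) X (1 ⊗ P)` with `P` of finite rank, where `φ` and `Tr(S ·)` agree. Traces against
trace-class operators then pass to the limit (`IsTraceSA.tendsto_opTrace_mul`).

The cones enter only through `IsAdmissible`. Compression preserves the first four. It may violate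
the `ρ`-constraints of the fifth, and a vanishing scalar correction away from row and column `0`
repairs this (`isAdmissible_pos_inter_spaceBρ''`). -/

/-! ### Hilbert–Schmidt operators -/

/-- `A` is Hilbert–Schmidt with respect to the Hilbert basis `b`. -/
def IsHilbertSchmidt (b : HilbertBasis ι ℂ H) (A : H →L[ℂ] H) : Prop :=
  Summable fun i => ‖A (b i)‖ ^ 2

lemma hasSum_norm_inner_sq (b : HilbertBasis ι ℂ H) (x : H) :
    HasSum (fun j => ‖inner ℂ (b j) x‖ ^ 2) (‖x‖ ^ 2) := by
  have h := (b.hasSum_inner_mul_inner x x).mapL Complex.reCLM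
  have e : ∀ j, Complex.reCLM (inner ℂ x (b j) * inner ℂ (b j) x) = ‖inner ℂ (b j) x‖ ^ 2 := by
    intro j
    rw [← inner_conj_symm x (b j), Complex.conj_mul']
    norm_cast
  simp only [e] at h
  rwa [Complex.reCLM_apply, ← RCLike.re_eq_complex_re, inner_self_eq_norm_sq] at h

lemma IsHilbertSchmidt.summable_prod {b : HilbertBasis ι ℂ H} {A : H →L[ℂ] H}
    (hA : IsHilbertSchmidt b A) :
    Summable fun p : ι × ι => ‖inner ℂ (b p.2) (A (b p.1))‖ ^ 2 := by
  rw [summable_prod_of_nonneg (fun p => sq_nonneg _)]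
  refine ⟨fun i => (hasSum_norm_inner_sq b (A (b i))).summable, ?_⟩
  refine Summable.congr hA fun i => ?_
  exact (hasSum_norm_inner_sq b (A (b i))).tsum_eq.symm

/-- By Parseval the sum is a double sum of squared moduli of matrix coefficients, and passing to the
adjoint only swaps the two indices. -/
lemma IsHilbertSchmidt.adjoint {b : HilbertBasis ι ℂ H} {A : H →L[ℂ] H}
    (hA : IsHilbertSchmidt b A) : IsHilbertSchmidt b (star A) := by
  have h := hA.summable_prod.prod_symm
  rw [summable_prod_of_nonneg (fun p => sq_nonneg _)] at h
  refine h.2.congr fun i => ?_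
  rw [← (hasSum_norm_inner_sq b (star A (b i))).tsum_eq]
  refine tsum_congr fun j => ?_
  rw [ContinuousLinearMap.star_eq_adjoint, ContinuousLinearMap.adjoint_inner_right,
    ← inner_conj_symm, RCLike.norm_conj, Prod.swap_prod_mk]

lemma IsHilbertSchmidt.comp_left {b : HilbertBasis ι ℂ H} {A : H →L[ℂ] H}
    (hA : IsHilbertSchmidt b A) (B : H →L[ℂ] H) : IsHilbertSchmidt b (B * A) := by
  refine Summable.of_nonneg_of_le (fun i => by positivity) (fun i => ?_) (Summable.mul_left (‖B‖ ^ 2) hA)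
  rw [← mul_pow]
  exact pow_le_pow_left₀ (norm_nonneg _) (B.le_opNorm _) 2

lemma IsHilbertSchmidt.comp_right {b : HilbertBasis ι ℂ H} {A : H →L[ℂ] H}
    (hA : IsHilbertSchmidt b A) (B : H →L[ℂ] H) : IsHilbertSchmidt b (A * B) := by
  simpa using (hA.adjoint.comp_left (star B)).adjoint

lemma IsHilbertSchmidt.summable_norm_mul {b : HilbertBasis ι ℂ H} {A C : H →L[ℂ] H}
    (hA : IsHilbertSchmidt b A) (hC : IsHilbertSchmidt b C) :
    Summable fun i => ‖A (b i)‖ * ‖C (b i)‖ := by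
  refine Summable.of_nonneg_of_le (fun i => by positivity) (fun i => ?_) (hA.add hC)
  nlinarith [sq_nonneg (‖A (b i)‖ - ‖C (b i)‖), sq_nonneg ‖A (b i)‖, sq_nonneg ‖C (b i)‖]

lemma IsHilbertSchmidt.summable_inner {b : HilbertBasis ι ℂ H} {A C : H →L[ℂ] H}
    (hA : IsHilbertSchmidt b A) (hC : IsHilbertSchmidt b C) :
    Summable fun i => inner ℂ (A (b i)) (C (b i)) :=
  (hA.summable_norm_mul hC).of_norm_bounded fun _ => norm_inner_le_norm _ _

/-- Cyclicity `Tr(A†C) = Tr(CA†)`: expand in matrix coefficients and exchange the sums, the double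
series being dominated by the two Hilbert–Schmidt sums. -/
lemma IsHilbertSchmidt.tsum_inner_star {b : HilbertBasis ι ℂ H} {A C : H →L[ℂ] H}
    (hA : IsHilbertSchmidt b A) (hC : IsHilbertSchmidt b C) :
    ∑' i, inner ℂ (A (b i)) (C (b i)) =
      ∑' i, inner ℂ (star C (b i)) (star A (b i)) := by
  have hs : Summable fun p : ι × ι =>
      inner ℂ (A (b p.1)) (b p.2) * inner ℂ (b p.2) (C (b p.1)) := by
    refine (hA.summable_prod.add hC.summable_prod).of_norm_bounded fun p => ?_
    rw [norm_mul, norm_inner_symm]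
    nlinarith [sq_nonneg (‖inner ℂ (b p.2) (A (b p.1))‖ - ‖inner ℂ (b p.2) (C (b p.1))‖),
      sq_nonneg ‖inner ℂ (b p.2) (A (b p.1))‖, sq_nonneg ‖inner ℂ (b p.2) (C (b p.1))‖]
  have hs' : Summable (Function.uncurry fun i j : ι =>
      inner ℂ (A (b i)) (b j) * inner ℂ (b j) (C (b i))) := hs
  have h := hs'.tsum_comm
  simp only [b.tsum_inner_mul_inner] at h
  rw [← h]
  refine tsum_congr fun j => ?_
  rw [← b.tsum_inner_mul_inner]
  refine tsum_congr fun i => ?_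
  simp only [ContinuousLinearMap.star_eq_adjoint, ContinuousLinearMap.adjoint_inner_left,
    ContinuousLinearMap.adjoint_inner_right]
  ring

lemma IsHilbertSchmidt.tsum_norm_sq_star {b : HilbertBasis ι ℂ H} {A : H →L[ℂ] H}
    (hA : IsHilbertSchmidt b A) :
    ∑' i, ‖star A (b i)‖ ^ 2 = ∑' i, ‖A (b i)‖ ^ 2 := by
  have h := hA.tsum_inner_star hA
  simp only [inner_self_eq_norm_sq_to_K] at h
  exact_mod_cast h.symm

/-! ### Positive operators with summable diagonal -/

section Positive

variable {b : HilbertBasis ι ℂ H} {D : H →L[ℂ] H}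

lemma isSelfAdjoint_sqrt (D : H →L[ℂ] H) : star (CFC.sqrt D) = CFC.sqrt D :=
  (IsSelfAdjoint.of_nonneg (CFC.sqrt_nonneg D)).star_eq

lemma inner_sqrt_left (D : H →L[ℂ] H) (x y : H) :
    inner ℂ (CFC.sqrt D x) y = inner ℂ x (CFC.sqrt D y) := by
  conv_lhs => rw [← isSelfAdjoint_sqrt D, ContinuousLinearMap.star_eq_adjoint,
    ContinuousLinearMap.adjoint_inner_left]

lemma sqrt_sqrt_apply (hD : 0 ≤ D) (x : H) : CFC.sqrt D (CFC.sqrt D x) = D x := by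
  rw [← mul_apply_eq_comp, CFC.sqrt_mul_sqrt_self D hD]

lemma re_inner_eq_norm_sqrt_sq (hD : 0 ≤ D) (x : H) :
    (inner ℂ x (D x)).re = ‖CFC.sqrt D x‖ ^ 2 := by
  rw [← sqrt_sqrt_apply hD, ← inner_sqrt_left, inner_self_eq_norm_sq_to_K]
  norm_cast

lemma isHilbertSchmidt_sqrt (hD : 0 ≤ D) (hs : Summable fun i => (inner ℂ (b i) (D (b i))).re) :
    IsHilbertSchmidt b (CFC.sqrt D) := by
  simp only [re_inner_eq_norm_sqrt_sq hD] at hs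
  exact hs

/-- Split `D = √D √D` and move one Hilbert–Schmidt factor around. The primed version reaches the
same value for the opposite order of the factors, which is what makes the trace cyclic. -/
lemma hasSum_inner_mul_of_nonneg (hD : 0 ≤ D)
    (hs : Summable fun i => (inner ℂ (b i) (D (b i))).re) (B : H →L[ℂ] H) :
    HasSum (fun i => inner ℂ (b i) (D (B (b i))))
      (∑' i, inner ℂ (CFC.sqrt D (b i)) (B (CFC.sqrt D (b i)))) := by
  have hR := isHilbertSchmidt_sqrt hD hs
  have h1 := (hR.summable_inner (hR.comp_right B)).hasSum
  rw [(hR.tsum_inner_star (hR.comp_right B))] at h1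
  simp only [star_mul, isSelfAdjoint_sqrt, mul_apply_eq_comp] at h1
  simp only [ContinuousLinearMap.star_eq_adjoint, ContinuousLinearMap.adjoint_inner_left] at h1
  simpa only [inner_sqrt_left D _ (CFC.sqrt D _), sqrt_sqrt_apply hD] using h1

lemma hasSum_inner_mul_of_nonneg' (hD : 0 ≤ D)
    (hs : Summable fun i => (inner ℂ (b i) (D (b i))).re) (B : H →L[ℂ] H) :
    HasSum (fun i => inner ℂ (b i) (B (D (b i))))
      (∑' i, inner ℂ (CFC.sqrt D (b i)) (B (CFC.sqrt D (b i)))) := by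
  have hR := isHilbertSchmidt_sqrt hD hs
  have h1 := ((hR.comp_right (star B)).summable_inner hR).hasSum
  rw [((hR.comp_right (star B)).tsum_inner_star hR)] at h1
  simp only [star_mul, star_star, isSelfAdjoint_sqrt, mul_apply_eq_comp] at h1
  simpa only [inner_sqrt_left D _ (CFC.sqrt D _), sqrt_sqrt_apply hD,
    ContinuousLinearMap.star_eq_adjoint, ContinuousLinearMap.adjoint_inner_left] using h1

/-- Each term is `⟨√D J† e, √D e⟩`, bounded by half the sum of the squared norms. The
Hilbert–Schmidt norm of `√D J†` equals that of its adjoint `J √D`, hence is at most that of `√D`. -/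
lemma sum_norm_inner_mul_le_of_nonneg (hD : 0 ≤ D)
    (hs : Summable fun i => (inner ℂ (b i) (D (b i))).re) (J : H →L[ℂ] H) (hJ : ‖J‖ ≤ 1)
    (F : Finset ι) :
    ∑ i ∈ F, ‖inner ℂ (b i) (J (D (b i)))‖ ≤ ∑' i, (inner ℂ (b i) (D (b i))).re := by
  have hR := isHilbertSchmidt_sqrt hD hs
  have hRJ := hR.comp_right (star J)
  have key : ∀ i, ‖inner ℂ (b i) (J (D (b i)))‖ ≤
      (1 / 2) * (‖(CFC.sqrt D * star J) (b i)‖ ^ 2 + ‖CFC.sqrt D (b i)‖ ^ 2) := by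
    intro i
    have : inner ℂ (b i) (J (D (b i))) =
        inner ℂ ((CFC.sqrt D * star J) (b i)) (CFC.sqrt D (b i)) := by
      rw [mul_apply_eq_comp, inner_sqrt_left, sqrt_sqrt_apply hD,
        ContinuousLinearMap.star_eq_adjoint, ContinuousLinearMap.adjoint_inner_left]
    rw [this]
    refine (norm_inner_le_norm _ _).trans ?_
    nlinarith [sq_nonneg (‖(CFC.sqrt D * star J) (b i)‖ - ‖CFC.sqrt D (b i)‖)]
  have hle : ∑' i, ‖(CFC.sqrt D * star J) (b i)‖ ^ 2 ≤ ∑' i, ‖CFC.sqrt D (b i)‖ ^ 2 := by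
    rw [← hRJ.tsum_norm_sq_star]
    refine Summable.tsum_le_tsum (fun i => ?_) hRJ.adjoint hR
    rw [star_mul, star_star, isSelfAdjoint_sqrt, mul_apply_eq_comp]
    refine pow_le_pow_left₀ (norm_nonneg _) ((J.le_opNorm _).trans ?_) 2
    exact mul_le_of_le_one_left (norm_nonneg _) hJ
  simp only [re_inner_eq_norm_sqrt_sq hD]
  calc ∑ i ∈ F, ‖inner ℂ (b i) (J (D (b i)))‖
      ≤ ∑ i ∈ F, (1 / 2) * (‖(CFC.sqrt D * star J) (b i)‖ ^ 2 + ‖CFC.sqrt D (b i)‖ ^ 2) :=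
        Finset.sum_le_sum fun i _ => key i
    _ ≤ ∑' i, (1 / 2) * (‖(CFC.sqrt D * star J) (b i)‖ ^ 2 + ‖CFC.sqrt D (b i)‖ ^ 2) :=
        ((hRJ.add hR).mul_left _).sum_le_tsum _ fun i _ => by positivity
    _ ≤ _ := by
        rw [tsum_mul_left, hRJ.tsum_add hR]
        linarith

end Positive

/-! ### Self-adjoint trace-class operators -/

lemma re_inner_nonneg {D : H →L[ℂ] H} (hD : 0 ≤ D) (x : H) : 0 ≤ (inner ℂ x (D x)).re :=
  ((ContinuousLinearMap.nonneg_iff_isPositive D).1 hD).re_inner_nonneg_right x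

lemma isTraceClass_iff_of_nonneg {D : H →L[ℂ] H} (hD : 0 ≤ D) :
    IsTraceClass D ↔ Summable fun i => (inner ℂ (basis H i) (D (basis H i))).re := by
  rw [IsTraceClass, CFC.abs_of_nonneg D hD]

/-- A difference of two positive operators with summable diagonals. -/
def IsTraceDiff (D : H →L[ℂ] H) : Prop :=
  ∃ P Q : H →L[ℂ] H, 0 ≤ P ∧ 0 ≤ Q ∧
    (Summable fun i => (inner ℂ (basis H i) (P (basis H i))).re) ∧
    (Summable fun i => (inner ℂ (basis H i) (Q (basis H i))).re) ∧ D = P - Q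

lemma IsTraceClass.isTraceDiff {D : H →L[ℂ] H} (hD : IsSelfAdjoint D) (ht : IsTraceClass D) :
    IsTraceDiff D := by
  have hadd := CFC.posPart_add_negPart D hD
  have hsub := CFC.posPart_sub_negPart D hD
  have hp : 0 ≤ D⁺ := CFC.posPart_nonneg D
  have hn : 0 ≤ D⁻ := CFC.negPart_nonneg D
  unfold IsTraceClass at ht
  have e : ∀ i, (inner ℂ (basis H i) (CFC.abs D (basis H i))).re =
      (inner ℂ (basis H i) (D⁺ (basis H i))).re + (inner ℂ (basis H i) (D⁻ (basis H i))).re := by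
    intro i
    rw [← hadd, add_apply, inner_add_right, Complex.add_re]
  simp only [e] at ht
  refine ⟨D⁺, D⁻, hp, hn, ?_, ?_, hsub.symm⟩
  · exact ht.of_nonneg_of_le (fun i => re_inner_nonneg hp _)
      fun i => le_add_of_nonneg_right (re_inner_nonneg hn _)
  · exact ht.of_nonneg_of_le (fun i => re_inner_nonneg hn _)
      fun i => le_add_of_nonneg_left (re_inner_nonneg hp _)

/-- An approximate polar decomposition. The sign function is not continuous, so `t / (|t| + ε)`
replaces it in the continuous functional calculus, with error `ε |t| / (|t| + ε) ≤ ε`. -/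
lemma exists_norm_abs_sub_mul_le {D : H →L[ℂ] H} (hD : IsSelfAdjoint D) {ε : ℝ} (hε : 0 < ε) :
    ∃ J : H →L[ℂ] H, ‖J‖ ≤ 1 ∧ ‖CFC.abs D - J * D‖ ≤ ε := by
  have hc : Continuous fun t : ℝ => t / (|t| + ε) :=
    continuous_id.div (by fun_prop) fun t => by positivity
  refine ⟨cfc (fun t : ℝ => t / (|t| + ε)) D, ?_, ?_⟩
  · refine norm_cfc_le zero_le_one fun t _ => ?_
    rw [Real.norm_eq_abs, abs_div, abs_of_pos (by positivity : 0 < |t| + ε)]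
    exact div_le_one_of_le₀ (by linarith) (by positivity)
  · have h1 : cfc (fun t : ℝ => t / (|t| + ε)) D * D = cfc (fun t : ℝ => t / (|t| + ε) * t) D := by
      conv_lhs => rw [← cfc_id' ℝ D]
      rw [cfc_id' ℝ D, cfc_mul _ _ D hc.continuousOn, cfc_id' ℝ D]
    have hc' : Continuous fun t : ℝ => t / (|t| + ε) * t := hc.mul continuous_id
    rw [h1, CFC.abs_eq_cfc_norm D hD,
      ← cfc_sub _ _ D continuous_norm.continuousOn hc'.continuousOn]
    refine norm_cfc_le hε.le fun t _ => ?_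
    have hpos : 0 < |t| + ε := by positivity
    have : ‖t‖ - t / (|t| + ε) * t = ε * (|t| / (|t| + ε)) := by
      rw [Real.norm_eq_abs]
      field_simp
      nlinarith [sq_abs t]
    rw [this, norm_mul, Real.norm_of_nonneg hε.le, Real.norm_of_nonneg (by positivity)]
    exact mul_le_of_le_one_right hε.le (div_le_one_of_le₀ (by linarith) hpos.le)

lemma re_inner_abs_sub_le {P Q J : H →L[ℂ] H} {ε : ℝ} (hJ : ‖CFC.abs (P - Q) - J * (P - Q)‖ ≤ ε)
    {x : H} (hx : ‖x‖ = 1) :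
    (inner ℂ x (CFC.abs (P - Q) x)).re ≤
      ‖inner ℂ x (J (P x))‖ + ‖inner ℂ x (J (Q x))‖ + ε := by
  have e : inner ℂ x (CFC.abs (P - Q) x) = inner ℂ x (J (P x)) - inner ℂ x (J (Q x)) +
      inner ℂ x ((CFC.abs (P - Q) - J * (P - Q)) x) := by
    rw [sub_apply, mul_apply_eq_comp, sub_apply, map_sub, inner_sub_right, inner_sub_right]
    ring
  have h3 : ‖inner ℂ x ((CFC.abs (P - Q) - J * (P - Q)) x)‖ ≤ ε := by
    refine (norm_inner_le_norm _ _).trans ?_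
    rw [hx, one_mul]
    refine (ContinuousLinearMap.le_opNorm _ _).trans ?_
    rwa [hx, mul_one]
  rw [e]
  exact (Complex.re_le_norm _).trans
    ((norm_add_le _ _).trans (add_le_add (norm_sub_le _ _) h3))

/-- The absolute value is not additive, so closure of the trace class under sums is obtained through
differences of positive operators. This is the nontrivial direction: approximately `|P - Q| = J (P -
Q)` with `‖J‖ ≤ 1`, so the partial sums are bounded by `Tr P + Tr Q`. -/
lemma summable_re_inner_abs_sub {b : HilbertBasis ι ℂ H} {P Q : H →L[ℂ] H} (hP : 0 ≤ P)
    (hQ : 0 ≤ Q) (sP : Summable fun i => (inner ℂ (b i) (P (b i))).re)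
    (sQ : Summable fun i => (inner ℂ (b i) (Q (b i))).re) :
    Summable fun i => (inner ℂ (b i) (CFC.abs (P - Q) (b i))).re := by
  have hD : IsSelfAdjoint (P - Q) := (IsSelfAdjoint.of_nonneg hP).sub (IsSelfAdjoint.of_nonneg hQ)
  have key : ∀ F : Finset ι, ∑ i ∈ F, (inner ℂ (b i) (CFC.abs (P - Q) (b i))).re ≤
      ∑' i, (inner ℂ (b i) (P (b i))).re + ∑' i, (inner ℂ (b i) (Q (b i))).re := by
    intro F
    refine le_of_forall_pos_le_add fun δ hδ => ?_
    -- The tolerance depends on `F`, so that the errors over all of `F` add up to at most `δ`; the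
    -- `+ 1` covers empty `F`.
    obtain ⟨J, hJ, hJε⟩ := exists_norm_abs_sub_mul_le hD
      (show 0 < δ / (F.card + 1) by positivity)
    refine (Finset.sum_le_sum fun i _ => re_inner_abs_sub_le hJε (b.orthonormal.1 i)).trans ?_
    rw [Finset.sum_add_distrib, Finset.sum_add_distrib, Finset.sum_const, nsmul_eq_mul]
    have h1 := sum_norm_inner_mul_le_of_nonneg hP sP J hJ F
    have h2 := sum_norm_inner_mul_le_of_nonneg hQ sQ J hJ F
    have h3 : (F.card : ℝ) * (δ / (F.card + 1)) ≤ δ := by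
      rw [mul_div_assoc', div_le_iff₀ (by positivity)]
      nlinarith
    exact add_le_add (add_le_add h1 h2) h3
  have h0 : ∀ i, 0 ≤ (inner ℂ (b i) (CFC.abs (P - Q) (b i))).re :=
    fun i => re_inner_nonneg (CFC.abs_nonneg (P - Q)) (b i)
  exact summable_of_sum_le h0 key

lemma IsTraceDiff.isTraceClass {D : H →L[ℂ] H} (h : IsTraceDiff D) : IsTraceClass D := by
  obtain ⟨P, Q, hP, hQ, sP, sQ, rfl⟩ := h
  exact summable_re_inner_abs_sub hP hQ sP sQ

/-- A self-adjoint trace-class operator. -/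
def IsTraceSA (D : H →L[ℂ] H) : Prop := IsSelfAdjoint D ∧ IsTraceClass D

lemma isTraceSA_iff {D : H →L[ℂ] H} : IsTraceSA D ↔ IsTraceDiff D := by
  refine ⟨fun h => h.2.isTraceDiff h.1, fun h => ⟨?_, h.isTraceClass⟩⟩
  obtain ⟨P, Q, hP, hQ, -, -, rfl⟩ := h
  exact (IsSelfAdjoint.of_nonneg hP).sub (IsSelfAdjoint.of_nonneg hQ)

lemma IsTraceDiff.neg {A : H →L[ℂ] H} (hA : IsTraceDiff A) : IsTraceDiff (-A) := by
  obtain ⟨P, Q, hP, hQ, sP, sQ, rfl⟩ := hA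
  exact ⟨Q, P, hQ, hP, sQ, sP, (neg_sub _ _)⟩

lemma IsTraceDiff.add {A B : H →L[ℂ] H} (hA : IsTraceDiff A) (hB : IsTraceDiff B) :
    IsTraceDiff (A + B) := by
  obtain ⟨P, Q, hP, hQ, sP, sQ, rfl⟩ := hA
  obtain ⟨P', Q', hP', hQ', sP', sQ', rfl⟩ := hB
  refine ⟨P + P', Q + Q', add_nonneg hP hP', add_nonneg hQ hQ', ?_, ?_, by abel⟩
  · simpa only [add_apply, inner_add_right, Complex.add_re] using sP.add sP'
  · simpa only [add_apply, inner_add_right, Complex.add_re] using sQ.add sQ'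

lemma IsTraceDiff.smul_of_nonneg {A : H →L[ℂ] H} (hA : IsTraceDiff A) {c : ℝ} (hc : 0 ≤ c) :
    IsTraceDiff (c • A) := by
  obtain ⟨P, Q, hP, hQ, sP, sQ, rfl⟩ := hA
  have e : ∀ (T : H →L[ℂ] H) (x : H), (inner ℂ x ((c • T) x)).re = c * (inner ℂ x (T x)).re := by
    intro T x
    rw [smul_apply, inner_smul_right_eq_smul, Complex.smul_re, smul_eq_mul]
  refine ⟨c • P, c • Q, smul_nonneg hc hP, smul_nonneg hc hQ, ?_, ?_, smul_sub _ _ _⟩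
  · simpa only [e] using sP.mul_left c
  · simpa only [e] using sQ.mul_left c

lemma IsTraceSA.neg {A : H →L[ℂ] H} (hA : IsTraceSA A) : IsTraceSA (-A) :=
  isTraceSA_iff.2 (isTraceSA_iff.1 hA).neg

lemma IsTraceSA.add {A B : H →L[ℂ] H} (hA : IsTraceSA A) (hB : IsTraceSA B) :
    IsTraceSA (A + B) :=
  isTraceSA_iff.2 ((isTraceSA_iff.1 hA).add (isTraceSA_iff.1 hB))

lemma IsTraceSA.sub {A B : H →L[ℂ] H} (hA : IsTraceSA A) (hB : IsTraceSA B) :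
    IsTraceSA (A - B) := by
  rw [sub_eq_add_neg]
  exact hA.add hB.neg

lemma IsTraceSA.smul {A : H →L[ℂ] H} (hA : IsTraceSA A) (c : ℝ) : IsTraceSA (c • A) := by
  rcases le_total 0 c with hc | hc
  · exact isTraceSA_iff.2 ((isTraceSA_iff.1 hA).smul_of_nonneg hc)
  · have := (isTraceSA_iff.2 ((isTraceSA_iff.1 hA).smul_of_nonneg (neg_nonneg.2 hc))).neg
    rwa [neg_smul, neg_neg] at this

lemma isTraceSA_zero : IsTraceSA (0 : H →L[ℂ] H) :=
  isTraceSA_iff.2 ⟨0, 0, le_rfl, le_rfl, by simp,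
    by simp, by simp⟩

lemma isTraceSA_sum {κ : Type*} (s : Finset κ) (A : κ → H →L[ℂ] H)
    (hA : ∀ i ∈ s, IsTraceSA (A i)) : IsTraceSA (∑ i ∈ s, A i) :=
  Finset.sum_induction A IsTraceSA (fun _ _ => IsTraceSA.add) isTraceSA_zero hA

/-! ### The trace -/

/-- The finite-rank projection onto the span of finitely many vectors of the fixed basis. -/
def proj (F : Finset (exists_hilbertBasis ℂ H).choose) : H →L[ℂ] H :=
  ∑ i ∈ F, rankOne ℂ (basis H i) (basis H i)

lemma star_proj (F : Finset (exists_hilbertBasis ℂ H).choose) :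
    star (proj F : H →L[ℂ] H) = proj F := by
  simp [proj, star_sum, ContinuousLinearMap.star_eq_adjoint]

lemma inner_proj_left (F : Finset (exists_hilbertBasis ℂ H).choose) (x y : H) :
    inner ℂ (proj F x) y = inner ℂ x (proj F y) := by
  conv_lhs => rw [← star_proj, ContinuousLinearMap.star_eq_adjoint,
    ContinuousLinearMap.adjoint_inner_left]

lemma proj_mul_proj (F : Finset (exists_hilbertBasis ℂ H).choose) :
    (proj F : H →L[ℂ] H) * proj F = proj F := by
  classical
  rw [proj, Finset.sum_mul_sum]
  refine Finset.sum_congr rfl fun i hi => ?_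
  have : ∀ j ∈ F, (rankOne ℂ (basis H i) (basis H i) : H →L[ℂ] H) *
      rankOne ℂ (basis H j) (basis H j) =
      if i = j then rankOne ℂ (basis H i) (basis H i) else 0 := by
    intro j _
    ext x
    rw [mul_apply_eq_comp, rankOne_apply, rankOne_apply, inner_smul_right,
      orthonormal_iff_ite.1 (basis H).orthonormal i j]
    split_ifs with h
    · subst h; simp
    · simp
  rw [Finset.sum_congr rfl this, Finset.sum_ite_eq, if_pos hi]

lemma norm_proj_apply_le (F : Finset (exists_hilbertBasis ℂ H).choose) (x : H) :
    ‖proj F x‖ ≤ ‖x‖ := by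
  have h : ‖proj F x‖ ^ 2 ≤ ‖x‖ * ‖proj F x‖ := by
    rw [← inner_self_eq_norm_sq (𝕜 := ℂ), inner_proj_left, ← mul_apply_eq_comp, proj_mul_proj]
    exact (RCLike.re_le_norm _).trans (norm_inner_le_norm _ _)
  by_contra! hlt
  nlinarith [norm_nonneg x]

lemma tendsto_proj_apply (x : H) :
    Tendsto (fun F : Finset (exists_hilbertBasis ℂ H).choose => proj F x) atTop (𝓝 x) := by
  have h := (basis H).hasSum_repr x
  simp only [HilbertBasis.repr_apply_apply] at h
  refine h.congr fun F => ?_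
  simp [proj]

lemma proj_le_one (F : Finset (exists_hilbertBasis ℂ H).choose) : (proj F : H →L[ℂ] H) ≤ 1 := by
  have := star_mul_self_nonneg (1 - proj F : H →L[ℂ] H)
  rw [star_sub, star_one, star_proj, mul_sub, sub_mul, sub_mul, proj_mul_proj] at this
  rw [← sub_nonneg]
  simpa using this

/-- The functional `B ↦ ∑ i, ⟨√P e i, B √P e i⟩`, for a positive operator `P`. -/
def sqrtTrace (P B : H →L[ℂ] H) : ℂ :=
  ∑' i, inner ℂ (CFC.sqrt P (basis H i)) (B (CFC.sqrt P (basis H i)))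

/-- The projections converge only strongly, but each term converges and is dominated by `‖B‖ ‖√P e
i‖²`, which is summable. -/
lemma tendsto_sqrtTrace {P : H →L[ℂ] H} (hP : 0 ≤ P)
    (sP : Summable fun i => (inner ℂ (basis H i) (P (basis H i))).re) (B : H →L[ℂ] H) :
    Tendsto (fun F => sqrtTrace P (proj F * B * proj F)) atTop (𝓝 (sqrtTrace P B)) := by
  have hR := isHilbertSchmidt_sqrt hP sP
  refine tendsto_tsum_of_dominated_convergence (bound := fun i =>
    ‖B‖ * ‖CFC.sqrt P (basis H i)‖ ^ 2) (Summable.mul_left _ hR) (fun i => ?_)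
    (Eventually.of_forall fun F i => ?_)
  · simp only [mul_apply_eq_comp, ← inner_proj_left]
    exact (tendsto_proj_apply _).inner ((B.continuous.tendsto _).comp (tendsto_proj_apply _))
  · simp only [mul_apply_eq_comp, ← inner_proj_left]
    refine (norm_inner_le_norm _ _).trans ?_
    have h1 := norm_proj_apply_le F (CFC.sqrt P (basis H i))
    have h2 := (B.le_opNorm (proj F (CFC.sqrt P (basis H i)))).trans
      (mul_le_mul_of_nonneg_left h1 (norm_nonneg _))
    calc _ ≤ ‖CFC.sqrt P (basis H i)‖ * (‖B‖ * ‖CFC.sqrt P (basis H i)‖) :=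
          mul_le_mul h1 h2 (norm_nonneg _) (norm_nonneg _)
      _ = _ := by ring

lemma IsTraceSA.exists_hasSum {D : H →L[ℂ] H} (hD : IsTraceSA D) :
    ∃ P Q : H →L[ℂ] H, 0 ≤ P ∧ 0 ≤ Q ∧
    (Summable fun i => (inner ℂ (basis H i) (P (basis H i))).re) ∧
    (Summable fun i => (inner ℂ (basis H i) (Q (basis H i))).re) ∧ ∀ B : H →L[ℂ] H,
      HasSum (fun i => inner ℂ (basis H i) ((D * B) (basis H i)))
        (sqrtTrace P B - sqrtTrace Q B) ∧
      HasSum (fun i => inner ℂ (basis H i) ((B * D) (basis H i)))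
        (sqrtTrace P B - sqrtTrace Q B) := by
  obtain ⟨P, Q, hP, hQ, sP, sQ, rfl⟩ := isTraceSA_iff.1 hD
  refine ⟨P, Q, hP, hQ, sP, sQ, fun B => ⟨?_, ?_⟩⟩
  · refine ((hasSum_inner_mul_of_nonneg hP sP B).sub
      (hasSum_inner_mul_of_nonneg hQ sQ B)).congr_fun fun i => ?_
    simp only [mul_apply_eq_comp, sub_apply, inner_sub_right]
  · refine ((hasSum_inner_mul_of_nonneg' hP sP B).sub
      (hasSum_inner_mul_of_nonneg' hQ sQ B)).congr_fun fun i => ?_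
    simp only [mul_apply_eq_comp, sub_apply, map_sub, inner_sub_right]

lemma IsTraceSA.hasSum_mul {D : H →L[ℂ] H} (hD : IsTraceSA D) (B : H →L[ℂ] H) :
    HasSum (fun i => inner ℂ (basis H i) ((D * B) (basis H i))) (opTrace (D * B)) := by
  obtain ⟨P, Q, -, -, -, -, h⟩ := hD.exists_hasSum
  exact (h B).1.summable.hasSum

lemma IsTraceSA.opTrace_mul_comm {D : H →L[ℂ] H} (hD : IsTraceSA D) (B : H →L[ℂ] H) :
    opTrace (B * D) = opTrace (D * B) := by
  obtain ⟨P, Q, -, -, -, -, h⟩ := hD.exists_hasSum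
  exact (h B).2.tsum_eq.trans (h B).1.tsum_eq.symm

lemma IsTraceSA.opTrace_mul_add {D : H →L[ℂ] H} (hD : IsTraceSA D) (B C : H →L[ℂ] H) :
    opTrace (D * (B + C)) = opTrace (D * B) + opTrace (D * C) := by
  have h := (hD.hasSum_mul B).add (hD.hasSum_mul C)
  rw [← h.tsum_eq]
  simp [opTrace, mul_add]

lemma opTrace_smul (c : ℂ) (B : H →L[ℂ] H) : opTrace (c • B) = c * opTrace B := by
  simp only [opTrace, smul_apply, inner_smul_right]
  exact tsum_mul_left

lemma opTrace_real_smul (c : ℝ) (B : H →L[ℂ] H) : opTrace (c • B) = c * opTrace B := by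
  rw [← opTrace_smul]
  congr 1

lemma opTrace_neg (B : H →L[ℂ] H) : opTrace (-B) = -opTrace B := by
  simpa using opTrace_smul (-1) B

lemma IsTraceSA.opTrace_add_mul {D E : H →L[ℂ] H} (hD : IsTraceSA D) (hE : IsTraceSA E)
    (B : H →L[ℂ] H) : opTrace ((D + E) * B) = opTrace (D * B) + opTrace (E * B) := by
  have h := (hD.hasSum_mul B).add (hE.hasSum_mul B)
  rw [← h.tsum_eq]
  simp [opTrace, add_mul]

lemma opTrace_star (B : H →L[ℂ] H) : opTrace (star B) = star (opTrace B) := by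
  rw [opTrace, opTrace, tsum_star]
  refine tsum_congr fun i => ?_
  rw [ContinuousLinearMap.star_eq_adjoint, ContinuousLinearMap.adjoint_inner_right]
  exact (inner_conj_symm _ _).symm

lemma IsTraceSA.opTrace_mul_star {D : H →L[ℂ] H} (hD : IsTraceSA D) (B : H →L[ℂ] H) :
    opTrace (D * star B) = star (opTrace (D * B)) := by
  rw [← opTrace_star, star_mul, hD.1.star_eq, hD.opTrace_mul_comm]

lemma IsTraceSA.im_opTrace_mul {D : H →L[ℂ] H} (hD : IsTraceSA D) {B : H →L[ℂ] H}
    (hB : IsSelfAdjoint B) : (opTrace (D * B)).im = 0 := by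
  have h := hD.opTrace_mul_star B
  rw [hB.star_eq] at h
  exact Complex.conj_eq_iff_im.1 h.symm

lemma IsTraceSA.tendsto_opTrace_mul {D : H →L[ℂ] H} (hD : IsTraceSA D) (B : H →L[ℂ] H) :
    Tendsto (fun F => opTrace (D * (proj F * B * proj F))) atTop (𝓝 (opTrace (D * B))) := by
  obtain ⟨P, Q, hP, hQ, sP, sQ, h⟩ := hD.exists_hasSum
  have e : ∀ C, opTrace (D * C) = sqrtTrace P C - sqrtTrace Q C := fun C => (h C).1.tsum_eq
  simp only [e]
  exact (tendsto_sqrtTrace hP sP B).sub (tendsto_sqrtTrace hQ sQ B)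

lemma re_tsum_inner_mul_nonneg {b : HilbertBasis ι ℂ H} {P B : H →L[ℂ] H} (hP : 0 ≤ P)
    (sP : Summable fun i => (inner ℂ (b i) (P (b i))).re) (hB : 0 ≤ B) :
    0 ≤ (∑' i, inner ℂ (b i) (P (B (b i)))).re := by
  have hR := isHilbertSchmidt_sqrt hP sP
  have hs := hR.summable_inner (hR.comp_left B)
  simp only [mul_apply_eq_comp] at hs
  rw [(hasSum_inner_mul_of_nonneg hP sP B).tsum_eq, Complex.re_tsum hs]
  have h0 : ∀ i, 0 ≤ (inner ℂ (CFC.sqrt P (b i)) (B (CFC.sqrt P (b i)))).re :=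
    fun i => re_inner_nonneg hB (CFC.sqrt P (b i))
  exact tsum_nonneg h0

lemma re_opTrace_mul_nonneg {P B : H →L[ℂ] H} (hP : 0 ≤ P) (ht : IsTraceClass P) (hB : 0 ≤ B) :
    0 ≤ (opTrace (P * B)).re :=
  re_tsum_inner_mul_nonneg hP ((isTraceClass_iff_of_nonneg hP).1 ht) hB

lemma opTrace_mul_rankOne (D : H →L[ℂ] H) (x y : H) :
    opTrace (D * rankOne ℂ x y) = inner ℂ y (D x) := by
  rw [opTrace, ← (basis H).tsum_inner_mul_inner]
  refine tsum_congr fun i => ?_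
  rw [mul_apply_eq_comp, rankOne_apply, map_smul, inner_smul_right]

/-! ### Conic duality -/

/-- Strong duality for a linear program over a convex cone `K` whose right-hand side `b` is an
algebraic interior point of the image of `K`. -/
theorem exists_dual_functional {V E : Type*} [AddCommGroup V] [Module ℝ V] [AddCommGroup E]
    [Module ℝ E] (K : PointedCone ℝ V) (A : V →ₗ[ℝ] E) (f : V →ₗ[ℝ] ℝ) {b : E} (hb : b ≠ 0) {v : ℝ}
    (hv : ∀ X ∈ K, A X = b → v ≤ f X) (hf : ∀ X ∈ K, 0 ≤ f X)
    (hneg : ∀ X ∈ K, ∀ t : ℝ, A X = t • b → 0 ≤ t)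
    (hcore : ∀ e : E, ∃ t : ℝ, ∃ X ∈ K, A X = e + t • b) :
    ∃ φ : E →ₗ[ℝ] ℝ, φ b = v ∧ ∀ X ∈ K, φ (A X) ≤ f X := by
  obtain ⟨ψ, hψ⟩ : ∃ ψ : E →ₗ[ℝ] ℝ, ψ b = 1 := by
    obtain ⟨ψ, hψ, -⟩ := Submodule.exists_le_ker_of_notMem (p := (⊥ : Submodule ℝ E)) (v := b)
      (by simpa using hb)
    exact ⟨(ψ b)⁻¹ • ψ, by simp [hψ]⟩
  -- The pairs (cost bound, right-hand side) achievable in `K`.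
  let s : PointedCone ℝ (ℝ × E) :=
    { carrier := {p | ∃ X ∈ K, A X = p.2 ∧ f X ≤ p.1}
      add_mem' := by
        rintro p q ⟨X, hX, h1, h2⟩ ⟨Y, hY, h3, h4⟩
        exact ⟨X + Y, K.add_mem hX hY, by simp [h1, h3], by simpa using add_le_add h2 h4⟩
      zero_mem' := ⟨0, K.zero_mem, by simp, by simp⟩
      smul_mem' := by
        rintro ⟨c, hc⟩ p ⟨X, hX, h1, h2⟩
        refine ⟨c • X, K.smul_mem hc hX, ?_, ?_⟩
        · rw [map_smul, h1]; rfl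
        · rw [map_smul]; exact mul_le_mul_of_nonneg_left h2 hc }
  -- On `ℝ × span {b}` this is `(r, t • b) ↦ r - t v`; `ψ` only reads off the coefficient `t`.
  -- Nonnegativity on `s` follows by rescaling to `t = 1` when `t > 0`, and from `hf` when `t = 0`.
  -- The domination condition of the extension theorem is `hcore`.
  let g : (ℝ × E) →ₗ[ℝ] ℝ := LinearMap.fst ℝ ℝ E - v • (ψ ∘ₗ LinearMap.snd ℝ ℝ E)
  let dom : Submodule ℝ (ℝ × E) := (⊤ : Submodule ℝ ℝ).prod (Submodule.span ℝ {b})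
  obtain ⟨h, hext, hpos⟩ := riesz_extension s (g.toPMap dom) (by
    rintro ⟨⟨r, e⟩, hre⟩ ⟨X, hX, h1, h2⟩
    obtain ⟨t, rfl⟩ := Submodule.mem_span_singleton.1 hre.2
    dsimp only at h1 h2
    have ht := hneg X hX t h1
    suffices t * v ≤ r by
      simpa [g, LinearMap.toPMap_apply, hψ, mul_comm] using this
    rcases ht.eq_or_lt with rfl | ht
    · simpa using (hf X hX).trans h2
    · have := hv (t⁻¹ • X) (K.smul_mem (inv_nonneg.2 ht.le) hX)
        (by rw [map_smul, h1, smul_smul, inv_mul_cancel₀ ht.ne', one_smul])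
      rw [map_smul, smul_eq_mul, ← div_eq_inv_mul, le_div_iff₀ ht] at this
      linarith) (by
    rintro ⟨r, e⟩
    obtain ⟨t, X, hX, h1⟩ := hcore e
    refine ⟨⟨(f X - r, t • b), ⟨trivial, Submodule.mem_span_singleton.2 ⟨t, rfl⟩⟩⟩, X, hX, ?_, ?_⟩
    · simp [h1, add_comm]
    · simp)
  have h10 : h (1, 0) = 1 := by
    have := hext ⟨(1, 0), ⟨trivial, Submodule.zero_mem _⟩⟩
    simpa [g, LinearMap.toPMap_apply] using this
  have h0b : h (0, b) = -v := by
    have := hext ⟨(0, b), ⟨trivial, Submodule.mem_span_singleton_self b⟩⟩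
    simpa [g, LinearMap.toPMap_apply, hψ] using this
  refine ⟨-(h ∘ₗ LinearMap.inr ℝ ℝ E), by simp [h0b], fun X hX => ?_⟩
  have h1 := hpos (f X, A X) ⟨X, hX, rfl, le_rfl⟩
  have h2 : ((f X, A X) : ℝ × E) = f X • (1, 0) + (0, A X) := by simp
  rw [h2, map_add, map_smul, h10] at h1
  simp only [smul_eq_mul, mul_one] at h1
  simp only [LinearMap.neg_apply, LinearMap.comp_apply, LinearMap.inr_apply]
  linarith

/-! ### The normal part of a positive functional -/

/-- The functional `B ↦ Tr (D B)`. -/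
def traceLM {D : H →L[ℂ] H} (hD : IsTraceSA D) : (H →L[ℂ] H) →ₗ[ℂ] ℂ where
  toFun B := opTrace (D * B)
  map_add' := hD.opTrace_mul_add
  map_smul' c B := by rw [mul_smul_comm, opTrace_smul]; rfl

@[simp] lemma traceLM_apply {D : H →L[ℂ] H} (hD : IsTraceSA D) (B : H →L[ℂ] H) :
    traceLM hD B = opTrace (D * B) := rfl

lemma proj_mul_mul_proj (F : Finset (exists_hilbertBasis ℂ H).choose) (N : H →L[ℂ] H) :
    proj F * N * proj F = ∑ i ∈ F, ∑ j ∈ F,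
      inner ℂ (basis H i) (N (basis H j)) • rankOne ℂ (basis H i) (basis H j) := by
  rw [proj, Finset.sum_mul, Finset.sum_mul_sum]
  refine Finset.sum_congr rfl fun i _ => Finset.sum_congr rfl fun j _ => ?_
  ext x
  simp [mul_apply_eq_comp, smul_smul, mul_comm]

lemma isSelfAdjoint_proj_mul_mul_proj (F : Finset (exists_hilbertBasis ℂ H).choose)
    {N : H →L[ℂ] H} (hN : IsSelfAdjoint N) : IsSelfAdjoint (proj F * N * proj F) := by
  rw [IsSelfAdjoint, star_mul, star_mul, star_proj, hN.star_eq, mul_assoc]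

section Functional

variable (ψ : selfAdjoint (H →L[ℂ] H) →ₗ[ℝ] ℝ)

/-- The complex-linear extension of a real functional on the self-adjoint operators. -/
def complexify : Module.Dual ℂ (H →L[ℂ] H) :=
  Module.Dual.extendRCLike (𝕜 := ℂ) (ψ ∘ₗ realPart : (H →L[ℂ] H) →ₗ[ℝ] ℝ)

lemma complexify_re (A : H →L[ℂ] H) : (complexify ψ A).re = ψ (realPart A) :=
  Module.Dual.re_extendRCLike_apply (𝕜 := ℂ) _ A

lemma complexify_im (A : H →L[ℂ] H) : (complexify ψ A).im = ψ (imaginaryPart A) := by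
  have h := Module.Dual.im_extendRCLike_apply (𝕜 := ℂ)
    (ψ ∘ₗ realPart : (H →L[ℂ] H) →ₗ[ℝ] ℝ) A
  refine h.trans ?_
  change -ψ (realPart (Complex.I • A)) = _
  rw [realPart_I_smul, map_neg, neg_neg]

/-- Since `-‖N‖ ≤ N ≤ ‖N‖`, positivity alone forces boundedness. This matters because the extension
theorem provides no continuity. -/
lemma abs_apply_le (hψ : ∀ M : selfAdjoint (H →L[ℂ] H), 0 ≤ M.1 → 0 ≤ ψ M)
    (N : selfAdjoint (H →L[ℂ] H)) :
    |ψ N| ≤ ‖N‖ * ψ 1 := by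
  have h1 := hψ (‖N‖ • 1 - N) (by
    have := IsSelfAdjoint.le_algebraMap_norm_self N.2
    rw [Algebra.algebraMap_eq_smul_one] at this
    simpa [sub_nonneg] using this)
  have h2 := hψ (‖N‖ • 1 + N) (by
    have := IsSelfAdjoint.neg_algebraMap_norm_le_self N.2
    rw [Algebra.algebraMap_eq_smul_one, neg_le_iff_add_nonneg] at this
    simpa [add_comm] using this)
  rw [map_sub, map_smul, smul_eq_mul] at h1
  rw [map_add, map_smul, smul_eq_mul] at h2
  exact abs_le.2 ⟨by linarith, by linarith⟩

lemma norm_complexify_le (hψ : ∀ M : selfAdjoint (H →L[ℂ] H), 0 ≤ M.1 → 0 ≤ ψ M)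
    (A : H →L[ℂ] H) :
    ‖complexify ψ A‖ ≤ 2 * ψ 1 * ‖A‖ := by
  have h1 : 0 ≤ ψ 1 := hψ 1 (by simp)
  refine (Complex.norm_le_abs_re_add_abs_im _).trans ?_
  rw [complexify_re, complexify_im]
  have h2 := (abs_apply_le ψ hψ (realPart A)).trans
    (mul_le_mul_of_nonneg_right (realPart.norm_le A) h1)
  have h3 := (abs_apply_le ψ hψ (imaginaryPart A)).trans
    (mul_le_mul_of_nonneg_right (imaginaryPart.norm_le A) h1)
  linarith

/-- The form `(v, w) ↦ ψ(|w⟩⟨v|)` is sesquilinear and bounded, as `‖|w⟩⟨v|‖ = ‖w‖ ‖v‖`, so it is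
represented by a bounded operator. -/
lemma exists_operator_of_positive (hψ : ∀ M : selfAdjoint (H →L[ℂ] H), 0 ≤ M.1 → 0 ≤ ψ M) :
    ∃ T : H →L[ℂ] H, ∀ x y, inner ℂ y (T x) = complexify ψ (rankOne ℂ x y) := by
  let B : H →L⋆[ℂ] H →L[ℂ] ℂ := LinearMap.mkContinuous₂
    (LinearMap.mk₂'ₛₗ (starRingEnd ℂ) (RingHom.id ℂ)
      (fun v w => complexify ψ (rankOne ℂ w v))
      (fun v₁ v₂ w => by simp) (fun c v w => by simp)
      (fun v w₁ w₂ => by simp) (fun c v w => by simp))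
    (2 * ψ 1) (fun v w => by
      refine (norm_complexify_le ψ hψ _).trans (le_of_eq ?_)
      rw [norm_rankOne]
      ring)
  refine ⟨star (continuousLinearMapOfBilin B), fun x y => ?_⟩
  rw [ContinuousLinearMap.star_eq_adjoint, ContinuousLinearMap.adjoint_inner_right,
    continuousLinearMapOfBilin_apply]
  rfl

/-- The normal part of a positive functional `ψ`: a positive trace-class operator `T` such that
`ψ` agrees with `Tr (T ·)` on finite-rank operators and `Tr T ≤ ψ 1`. -/
theorem exists_normal_part (hψ : ∀ M : selfAdjoint (H →L[ℂ] H), 0 ≤ M.1 → 0 ≤ ψ M) :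
    ∃ T : H →L[ℂ] H, IsTraceSA T ∧ (opTrace T).re ≤ ψ 1 ∧
      ∀ (F : Finset (exists_hilbertBasis ℂ H).choose) (N : selfAdjoint (H →L[ℂ] H)),
        ψ ⟨proj F * N.1 * proj F, isSelfAdjoint_proj_mul_mul_proj F N.2⟩ =
          (opTrace (T * (proj F * N.1 * proj F))).re := by
  obtain ⟨T, hT⟩ := exists_operator_of_positive ψ hψ
  have hre : ∀ {M : H →L[ℂ] H} (hM : IsSelfAdjoint M), (complexify ψ M).re = ψ ⟨M, hM⟩ := by
    intro M hM
    rw [complexify_re]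
    congr 1
    ext1
    exact hM.coe_realPart
  have hpos : 0 ≤ T := by
    rw [ContinuousLinearMap.nonneg_iff_isPositive, ContinuousLinearMap.isPositive_iff_complex]
    intro x
    have hM : IsSelfAdjoint (rankOne ℂ x x : H →L[ℂ] H) :=
      (isPositive_rankOne_self x).isSelfAdjoint
    have him : (inner ℂ x (T x)).im = 0 := by
      rw [hT, complexify_im, hM.imaginaryPart, map_zero]
    have hnn : 0 ≤ (inner ℂ x (T x)).re := by
      rw [hT, hre hM]
      exact hψ _ ((ContinuousLinearMap.nonneg_iff_isPositive _).2 (isPositive_rankOne_self x))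
    have hr : (inner ℂ (T x) x).re = (inner ℂ x (T x)).re := by
      rw [← inner_conj_symm, Complex.conj_re]
    have hi : (inner ℂ (T x) x).im = 0 := by
      rw [← inner_conj_symm, Complex.conj_im, him, neg_zero]
    refine ⟨Complex.ext (by simp) (by simp [hi]), ?_⟩
    rw [← hr] at hnn
    exact hnn
  -- The partial traces of `T` are the values `ψ(P_F)`, and `P_F ≤ 1`.
  have hsum : ∀ F : Finset (exists_hilbertBasis ℂ H).choose,
      ∑ i ∈ F, (inner ℂ (basis H i) (T (basis H i))).re ≤ ψ 1 := by
    intro F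
    have hM : IsSelfAdjoint (proj F : H →L[ℂ] H) := star_proj F
    have e : ∑ i ∈ F, (inner ℂ (basis H i) (T (basis H i))).re =
        ψ (⟨proj F, hM⟩ : selfAdjoint (H →L[ℂ] H)) := by
      rw [← hre hM, proj, map_sum, Complex.re_sum]
      exact Finset.sum_congr rfl fun i _ => by rw [hT]
    have h := hψ (1 - (⟨proj F, hM⟩ : selfAdjoint (H →L[ℂ] H))) (by simpa using proj_le_one F)
    rw [map_sub] at h
    linarith
  have hs : Summable fun i => (inner ℂ (basis H i) (T (basis H i))).re := by
    have h0 : ∀ i, 0 ≤ (inner ℂ (basis H i) (T (basis H i))).re :=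
      fun i => re_inner_nonneg hpos (basis H i)
    exact summable_of_sum_le h0 hsum
  have hTt : IsTraceSA T := ⟨IsSelfAdjoint.of_nonneg hpos, (isTraceClass_iff_of_nonneg hpos).2 hs⟩
  refine ⟨T, hTt, ?_, fun F N => ?_⟩
  · have h1 := hTt.hasSum_mul 1
    rw [mul_one] at h1
    rw [opTrace, Complex.re_tsum h1.summable]
    exact hs.tsum_le_of_sum_le hsum
  · rw [← hre, ← traceLM_apply hTt, proj_mul_mul_proj]
    simp only [map_sum, map_smul, traceLM_apply, opTrace_mul_rankOne, hT]

end Functional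

/-! ### Dual operators -/

/-- If the trace vectors did not fill `ℝ^d`, a nonzero functional `f` would vanish on all of them.
Testing on `|x⟩⟨x|` makes the quadratic form of `∑ j, f_j D j` zero, hence the operator zero,
against linear independence. -/
theorem exists_dual_operators {d : ℕ} (D : Fin d → H →L[ℂ] H) (hD : ∀ j, IsTraceSA (D j))
    (hli : LinearIndependent ℝ D) (m : Fin d → ℝ) :
    ∃ B : H →L[ℂ] H, IsSelfAdjoint B ∧ ∀ j, (opTrace (D j * B)).re = m j := by
  let L : selfAdjoint (H →L[ℂ] H) →ₗ[ℝ] (Fin d → ℝ) :=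
    { toFun := fun N j => (opTrace (D j * N.1)).re
      map_add' := fun M N => by
        ext j
        simp [(hD j).opTrace_mul_add]
      map_smul' := fun c N => by
        ext j
        simp [opTrace_real_smul] }
  suffices h : LinearMap.range L = ⊤ by
    obtain ⟨N, hN⟩ := LinearMap.range_eq_top.1 h m
    exact ⟨N, N.2, fun j => congrFun hN j⟩
  by_contra hne
  obtain ⟨f, hf0, hf⟩ := Submodule.exists_le_ker_of_lt_top _ (lt_top_iff_ne_top.2 hne)
  have hfx : ∀ x : Fin d → ℝ, f x = ∑ j, f (Pi.single j 1) * x j := by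
    intro x
    conv_lhs => rw [← LinearMap.sum_single_apply (fun _ : Fin d => ℝ) x]
    rw [map_sum]
    refine Finset.sum_congr rfl fun j _ => ?_
    rw [mul_comm, ← smul_eq_mul, ← map_smul]
    congr 1
    ext k
    by_cases hk : k = j
    · subst hk; simp
    · simp [hk]
  have hz : ∑ j, f (Pi.single j 1) • D j = 0 := by
    have hL : ∀ x : H, inner ℂ ((∑ j, f (Pi.single j 1) • D j) x) x = 0 := by
      intro x
      have hM : IsSelfAdjoint (rankOne ℂ x x : H →L[ℂ] H) :=
        (isPositive_rankOne_self x).isSelfAdjoint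
      have h0 : f (L ⟨rankOne ℂ x x, hM⟩) = 0 := hf ⟨_, rfl⟩
      rw [hfx] at h0
      have h1 : ∀ j, inner ℂ x (D j x) = ((L ⟨rankOne ℂ x x, hM⟩ j : ℝ) : ℂ) := by
        intro j
        rw [← opTrace_mul_rankOne]
        exact Complex.ext rfl ((hD j).im_opTrace_mul hM)
      rw [← inner_conj_symm, sum_apply, inner_sum]
      simp only [smul_apply, inner_smul_right_eq_smul, h1, Complex.real_smul]
      rw [← Complex.ofReal_zero, ← h0]
      simp
    have hT := inner_map_self_eq_zero (T := ((∑ j, f (Pi.single j 1) • D j : H →L[ℂ] H) :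
      H →ₗ[ℂ] H)) |>.1 hL
    exact ContinuousLinearMap.coe_injective hT
  have hc := Fintype.linearIndependent_iff.1 hli _ hz
  apply hf0
  ext j
  simpa using hc j

/-! ### Traces of block operators -/

@[simp] lemma opTrace_zero : opTrace (0 : H →L[ℂ] H) = 0 := by
  simp [opTrace]

lemma opTrace_sum_mul {κ : Type*} (s : Finset κ) (D B : κ → H →L[ℂ] H)
    (hD : ∀ i ∈ s, IsTraceSA (D i)) :
    opTrace (∑ i ∈ s, D i * B i) = ∑ i ∈ s, opTrace (D i * B i) := by
  rw [← (hasSum_sum fun i hi => (hD i hi).hasSum_mul (B i)).tsum_eq]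
  simp [opTrace, sum_apply]

lemma blockTrace_mul {W : BlockOp d H} (hW : ∀ k j, IsTraceSA (W k j)) (Y : BlockOp d H) :
    blockTrace (W * Y) = ∑ k, ∑ j, opTrace (W k j * Y j k) := by
  rw [blockTrace, Matrix.trace]
  simp only [Matrix.diag_apply, Matrix.mul_apply]
  rw [← Finset.sum_product', ← Finset.sum_product', opTrace_sum_mul]
  exact fun p _ => hW _ _

lemma tens_apply (T : Matrix (Fin (d + 1)) (Fin (d + 1)) ℝ) (M : H →L[ℂ] H) (k j : Fin (d + 1)) :
    tens T M k j = T k j • M := rfl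

lemma blockTrace_tens_mul {D : H →L[ℂ] H} (hD : IsTraceSA D)
    (T : Matrix (Fin (d + 1)) (Fin (d + 1)) ℝ) (X : BlockOp d H) :
    blockTrace (tens T D * X) = ∑ k, ∑ j, (T k j : ℂ) * opTrace (D * X j k) := by
  rw [blockTrace_mul (W := tens T D) fun k j => hD.smul (T k j)]
  simp only [tens_apply, smul_mul_assoc, opTrace_real_smul]

lemma symUnit_zero_zero (i : Fin d) : symUnit i 0 0 = 0 := by
  simp [symUnit]

lemma symUnit_succ_succ (i k j : Fin d) : symUnit i k.succ j.succ = 0 := by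
  simp [symUnit, (Fin.succ_ne_zero _).symm]

lemma symUnit_zero_succ (i j : Fin d) : symUnit i 0 j.succ = if i = j then 1 / 2 else 0 := by
  simp [symUnit, Matrix.single_apply]

lemma symUnit_succ_zero (i j : Fin d) : symUnit i j.succ 0 = if i = j then 1 / 2 else 0 := by
  simp [symUnit, Matrix.single_apply]

lemma extend_zero_left (G : Matrix (Fin d) (Fin d) ℝ) (j : Fin (d + 1)) : extend G 0 j = 0 := by
  simp [extend, Matrix.sum_apply]

lemma extend_zero_right (G : Matrix (Fin d) (Fin d) ℝ) (j : Fin (d + 1)) : extend G j 0 = 0 := by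
  simp [extend, Matrix.sum_apply]

lemma extend_succ_succ (G : Matrix (Fin d) (Fin d) ℝ) (i j : Fin d) :
    extend G i.succ j.succ = G i j := by
  simp [extend, Matrix.sum_apply, Matrix.single_apply, Fin.succ_inj, ite_and]

lemma blockTrace_tens_symUnit_mul {D : H →L[ℂ] H} (hD : IsTraceSA D) (i : Fin d)
    (X : BlockOp d H) : blockTrace (tens (symUnit i) D * X) =
      (1 / 2) * (opTrace (D * X i.succ 0) + opTrace (D * X 0 i.succ)) := by
  rw [blockTrace_tens_mul hD]
  simp only [Fin.sum_univ_succ, symUnit_zero_zero, symUnit_succ_succ, symUnit_zero_succ,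
    symUnit_succ_zero]
  simp [apply_ite, ite_mul]
  ring

lemma blockTrace_tens_extend_mul {ρ : H →L[ℂ] H} (hρ : IsTraceSA ρ)
    (G : Matrix (Fin d) (Fin d) ℝ) (X : BlockOp d H) :
    blockTrace (tens (extend G) ρ * X) =
      ∑ i, ∑ j, (G i j : ℂ) * opTrace (ρ * X j.succ i.succ) := by
  rw [blockTrace_tens_mul hρ]
  simp [Fin.sum_univ_succ, extend_zero_left, extend_zero_right, extend_succ_succ]

lemma trace_tens_single_mul (X : BlockOp d H) :
    Matrix.trace (tens (Matrix.single 0 0 1) 1 * X) = X 0 0 := by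
  simp only [Matrix.trace, Matrix.diag_apply, Matrix.mul_apply, tens_apply, Matrix.single_apply]
  rw [Finset.sum_eq_single 0, Finset.sum_eq_single 0]
  · simp
  · intro j _ hj; simp [hj.symm]
  · simp
  · intro k _ hk; simp [hk.symm]
  · simp

lemma blockTrace_mul_tens_antisymUnit {ρ : H →L[ℂ] H} (hρ : IsTraceSA ρ) (X : BlockOp d H)
    (i j : Fin d) : blockTrace (X * tens (antisymUnit i j) ρ) =
      opTrace (ρ * X i.succ j.succ) - opTrace (ρ * X j.succ i.succ) := by
  have e : Matrix.trace (X * tens (antisymUnit i j) ρ) =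
      (X i.succ j.succ - X j.succ i.succ) * ρ := by
    have h : ∀ a c : Fin (d + 1), Matrix.trace (X * tens (Matrix.single a c 1) ρ) = X c a * ρ := by
      intro a c
      simp only [Matrix.trace, Matrix.diag_apply, Matrix.mul_apply, tens_apply,
        Matrix.single_apply]
      rw [Finset.sum_eq_single c, Finset.sum_eq_single a]
      · simp
      · intro l _ hl; simp [hl.symm]
      · simp
      · intro k _ hk; simp [hk.symm]
      · simp
    have hs : tens (antisymUnit i j) ρ =
        (tens (Matrix.single j.succ i.succ 1) ρ - tens (Matrix.single i.succ j.succ 1) ρ :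
          BlockOp d H) := by
      ext1 k l
      simp [tens_apply, antisymUnit, sub_smul]
    rw [hs, mul_sub, Matrix.trace_sub, h, h, sub_mul]
  rw [blockTrace, e, hρ.opTrace_mul_comm]
  exact map_sub (traceLM hρ) _ _

/-- The functional `X ↦ Re Tr ((T ⊗ D) X)`. -/
def traceTens (T : Matrix (Fin (d + 1)) (Fin (d + 1)) ℝ) {D : H →L[ℂ] H} (hD : IsTraceSA D) :
    BlockOp d H →ₗ[ℝ] ℝ where
  toFun X := (blockTrace (tens T D * X)).re
  map_add' X Y := by
    rw [blockTrace_tens_mul hD, blockTrace_tens_mul hD, blockTrace_tens_mul hD]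
    simp only [Matrix.add_apply, hD.opTrace_mul_add]
    simp only [mul_add, Finset.sum_add_distrib, Complex.add_re]
  map_smul' c X := by
    rw [blockTrace_tens_mul hD, blockTrace_tens_mul hD]
    simp only [Matrix.smul_apply, mul_smul_comm, opTrace_real_smul,
      mul_left_comm _ (c : ℂ), ← Finset.mul_sum, Complex.re_ofReal_mul, RingHom.id_apply,
      smul_eq_mul]

lemma traceTens_apply (T : Matrix (Fin (d + 1)) (Fin (d + 1)) ℝ) {D : H →L[ℂ] H}
    (hD : IsTraceSA D) (X : BlockOp d H) :
    traceTens T hD X = (blockTrace (tens T D * X)).re := rfl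

/-- In `ℬ''` the blocks at `(0, i)` and `(i, 0)` are equal and self-adjoint. The complex constraints
are thus equivalent to real ones. -/
lemma blockTrace_tens_symUnit_mul_of_mem {D : H →L[ℂ] H} (hD : IsTraceSA D) (i : Fin d)
    {X : BlockOp d H} (hX : X ∈ spaceB'' d H) :
    blockTrace (tens (symUnit i) D * X) = ((opTrace (D * X 0 i.succ)).re : ℂ) := by
  have h1 : X 0 i.succ = X i.succ 0 := by
    rw [hX.2 0 i.succ, (hX.1 i.succ).star_eq]
  rw [blockTrace_tens_symUnit_mul hD, h1]
  apply Complex.ext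
  · simp; ring
  · simp [hD.im_opTrace_mul (hX.1 i.succ)]

lemma dualOp_apply (G : Matrix (Fin d) (Fin d) ℝ) (ρ : H →L[ℂ] H) (D : Fin d → H →L[ℂ] H)
    (a : Matrix (Fin d) (Fin d) ℝ) (S : H →L[ℂ] H) (k l : Fin (d + 1)) :
    dualOp G ρ D a S k l = extend G k l • ρ - ∑ i, ∑ j, a i j • symUnit i k l • D j -
      (Matrix.single 0 0 1 : Matrix (Fin (d + 1)) (Fin (d + 1)) ℝ) k l • S := by
  simp [dualOp, Matrix.sum_apply, tens_apply]

lemma isTraceSA_dualOp {G : Matrix (Fin d) (Fin d) ℝ} {ρ : H →L[ℂ] H} {D : Fin d → H →L[ℂ] H}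
    {S : H →L[ℂ] H} (hρ : IsTraceSA ρ) (hD : ∀ j, IsTraceSA (D j)) (hS : IsTraceSA S)
    (a : Matrix (Fin d) (Fin d) ℝ) (k l : Fin (d + 1)) : IsTraceSA (dualOp G ρ D a S k l) := by
  rw [dualOp_apply]
  refine ((hρ.smul _).sub (isTraceSA_sum _ _ fun i _ => isTraceSA_sum _ _ fun j _ => ?_)).sub
    (hS.smul _)
  exact ((hD j).smul _).smul _

lemma extend_symm {G : Matrix (Fin d) (Fin d) ℝ} (hG : G.IsSymm) (k l : Fin (d + 1)) :
    extend G k l = extend G l k := by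
  cases k using Fin.cases <;> cases l using Fin.cases <;>
    simp only [extend_zero_left, extend_zero_right, extend_succ_succ]
  exact hG.apply _ _

lemma symUnit_symm (i : Fin d) (k l : Fin (d + 1)) : symUnit i k l = symUnit i l k := by
  cases k using Fin.cases <;> cases l using Fin.cases <;>
    simp only [symUnit_zero_zero, symUnit_zero_succ, symUnit_succ_zero, symUnit_succ_succ]

lemma dualOp_mem_spaceT {G : Matrix (Fin d) (Fin d) ℝ} (hG : G.IsSymm) {ρ : H →L[ℂ] H}
    {D : Fin d → H →L[ℂ] H} {S : H →L[ℂ] H} (hρ : IsTraceSA ρ) (hD : ∀ j, IsTraceSA (D j))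
    (hS : IsTraceSA S) (a : Matrix (Fin d) (Fin d) ℝ) : dualOp G ρ D a S ∈ spaceT d H := by
  intro k l
  have h := isTraceSA_dualOp (G := G) hρ hD hS a k l
  refine ⟨h.1, h.2, ?_⟩
  rw [dualOp_apply, dualOp_apply, extend_symm hG k l]
  simp only [symUnit_symm _ k l, Matrix.single_apply, and_comm]

/-- The Lagrangian of the program, from which both weak duality and dual feasibility are read off.
-/
lemma re_blockTrace_dualOp_mul {G : Matrix (Fin d) (Fin d) ℝ} {ρ : H →L[ℂ] H}
    {D : Fin d → H →L[ℂ] H} {S : H →L[ℂ] H} (hρ : IsTraceSA ρ) (hD : ∀ j, IsTraceSA (D j))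
    (hS : IsTraceSA S) (a : Matrix (Fin d) (Fin d) ℝ) (X : BlockOp d H) :
    (blockTrace (dualOp G ρ D a S * X)).re = traceTens (extend G) hρ X -
      ∑ i, ∑ j, a i j * traceTens (symUnit i) (hD j) X - (opTrace (S * X 0 0)).re := by
  have hsub : ∀ {A B : H →L[ℂ] H}, IsTraceSA A → IsTraceSA B → ∀ Y : H →L[ℂ] H,
      opTrace ((A - B) * Y) = opTrace (A * Y) - opTrace (B * Y) := by
    intro A B hA hB Y
    rw [sub_eq_add_neg, hA.opTrace_add_mul hB.neg, neg_mul, opTrace_neg, sub_eq_add_neg]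
  have hterm : ∀ k l, IsTraceSA (∑ i, ∑ j, a i j • symUnit i k l • D j) := fun k l =>
    isTraceSA_sum _ _ fun i _ => isTraceSA_sum _ _ fun j _ => ((hD j).smul _).smul _
  have hmid : ∀ k l, opTrace ((∑ i, ∑ j, a i j • symUnit i k l • D j) * X l k) =
      ∑ i, ∑ j, (a i j : ℂ) * ((symUnit i k l : ℂ) * opTrace (D j * X l k)) := by
    intro k l
    simp only [Finset.sum_mul]
    rw [← Finset.sum_product', ← Finset.sum_product', opTrace_sum_mul]
    · simp only [smul_mul_assoc, opTrace_real_smul]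
    · exact fun p _ => ((hD _).smul _).smul _
  have hS' : ∑ k, ∑ l, opTrace (((Matrix.single 0 0 1 : Matrix (Fin (d + 1)) (Fin (d + 1)) ℝ) k l
      • S) * X l k) = opTrace (S * X 0 0) := by
    simp only [smul_mul_assoc, opTrace_real_smul, Matrix.single_apply]
    rw [Finset.sum_eq_single 0, Finset.sum_eq_single 0]
    · simp
    · intro j _ hj; simp [hj.symm]
    · simp
    · intro k _ hk; simp [hk.symm]
    · simp
  have e : blockTrace (dualOp G ρ D a S * X) = blockTrace (tens (extend G) ρ * X) -
      ∑ i, ∑ j, (a i j : ℂ) * blockTrace (tens (symUnit i) (D j) * X) - opTrace (S * X 0 0) := by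
    rw [blockTrace_mul (isTraceSA_dualOp hρ hD hS a), ← hS', blockTrace_tens_mul hρ]
    simp only [blockTrace_tens_mul (hD _), dualOp_apply]
    simp only [hsub ((hρ.smul _).sub (hterm _ _)) (hS.smul _), hsub (hρ.smul _) (hterm _ _), hmid,
      Finset.sum_sub_distrib]
    simp only [smul_mul_assoc, opTrace_real_smul, Finset.mul_sum]
    congr 2
    rw [← Finset.sum_product']
    simp only [← Finset.sum_product' (s := Finset.univ) (t := Finset.univ)]
    rw [Finset.sum_comm]
  rw [e, Complex.sub_re, Complex.sub_re, Complex.re_sum]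
  simp only [Complex.re_sum, Complex.re_ofReal_mul, traceTens_apply]

/-! ### Convex cones of block operators -/

/-- A set closed under addition and multiplication by nonnegative reals, containing zero. -/
structure IsConic {V : Type*} [AddCommGroup V] [Module ℝ V] (K : Set V) : Prop where
  zero_mem : (0 : V) ∈ K
  add_mem : ∀ {X Y}, X ∈ K → Y ∈ K → X + Y ∈ K
  smul_mem : ∀ {c : ℝ} {X}, 0 ≤ c → X ∈ K → c • X ∈ K

section IsConic

variable {V : Type*} [AddCommGroup V] [Module ℝ V] {K L : Set V}

lemma IsConic.inter (hK : IsConic K) (hL : IsConic L) : IsConic (K ∩ L) :=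
  ⟨⟨hK.zero_mem, hL.zero_mem⟩, fun hX hY => ⟨hK.add_mem hX.1 hY.1, hL.add_mem hX.2 hY.2⟩,
    fun hc hX => ⟨hK.smul_mem hc hX.1, hL.smul_mem hc hX.2⟩⟩

lemma IsConic.convex (hK : IsConic K) : Convex ℝ K :=
  fun _ hX _ hY _ _ ha hb _ => hK.add_mem (hK.smul_mem ha hX) (hK.smul_mem hb hY)

lemma IsConic.sum_mem (hK : IsConic K) {κ : Type*} (s : Finset κ) (X : κ → V)
    (hX : ∀ i ∈ s, X i ∈ K) : ∑ i ∈ s, X i ∈ K :=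
  Finset.sum_induction X (· ∈ K) (fun _ _ => hK.add_mem) hK.zero_mem hX

/-- Scaling passes to the hull, and a sum is twice a midpoint. -/
lemma isConic_convexHull {P : Set V} (h0 : (0 : V) ∈ P)
    (hs : ∀ {c : ℝ} {X}, 0 ≤ c → X ∈ P → c • X ∈ P) : IsConic (convexHull ℝ P) := by
  have hsmul : ∀ {c : ℝ} {X}, 0 ≤ c → X ∈ convexHull ℝ P → c • X ∈ convexHull ℝ P := by
    intro c X hc hX
    have h1 : c • X ∈ (c • LinearMap.id : V →ₗ[ℝ] V) '' convexHull ℝ P := ⟨X, hX, rfl⟩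
    rw [LinearMap.image_convexHull] at h1
    refine convexHull_mono ?_ h1
    rintro _ ⟨Y, hY, rfl⟩
    exact hs hc hY
  refine ⟨subset_convexHull ℝ P h0, fun {X Y} hX hY => ?_, hsmul⟩
  have h := convex_convexHull ℝ P hX hY (by norm_num : (0 : ℝ) ≤ 1 / 2)
    (by norm_num : (0 : ℝ) ≤ 1 / 2) (by norm_num)
  have h2 := hsmul (zero_le_two) h
  rwa [smul_add, smul_smul, smul_smul, mul_one_div_cancel two_ne_zero, one_smul, one_smul] at h2

/-- A conic set as a pointed cone. -/
def IsConic.toPointedCone (hK : IsConic K) : PointedCone ℝ V where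
  carrier := K
  add_mem' := hK.add_mem
  zero_mem' := hK.zero_mem
  smul_mem' c _ hX := hK.smul_mem c.2 hX

end IsConic

lemma isConic_posCone : IsConic (posCone d H) := by
  refine ⟨⟨Matrix.isHermitian_zero, fun v => by simp [quadForm]⟩, fun {X Y} hX hY =>
    ⟨hX.1.add hY.1, fun v => ?_⟩, fun {c X} hc hX => ⟨?_, fun v => ?_⟩⟩
  · have e : quadForm (X + Y) v = quadForm X v + quadForm Y v := by
      simp [quadForm, Finset.sum_add_distrib]
    rw [e, Complex.add_re]
    exact add_nonneg (hX.2 v) (hY.2 v)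
  · rw [Matrix.IsHermitian, Matrix.conjTranspose_smul, hX.1, star_trivial]
  · have e : quadForm (c • X) v = c * quadForm X v := by
      simp [quadForm, inner_smul_right_eq_smul, Finset.mul_sum]
    rw [e, Complex.re_ofReal_mul]
    exact mul_nonneg hc (hX.2 v)

lemma isConic_spaceB : IsConic (spaceB d H) := by
  refine ⟨fun k j => ⟨IsSelfAdjoint.zero _, rfl⟩, fun {X Y} hX hY k j =>
    ⟨(hX k j).1.add (hY k j).1, ?_⟩, fun {c X} _ hX k j =>
    ⟨(IsSelfAdjoint.all c).smul (hX k j).1, ?_⟩⟩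
  · rw [Matrix.add_apply, Matrix.add_apply, (hX k j).2, (hY k j).2]
  · rw [Matrix.smul_apply, Matrix.smul_apply, (hX k j).2]

lemma isConic_spaceB'' : IsConic (spaceB'' d H) := by
  refine ⟨⟨fun k => IsSelfAdjoint.zero _, fun k j => by simp⟩, fun {X Y} hX hY =>
    ⟨fun k => (hX.1 k).add (hY.1 k), fun k j => ?_⟩, fun {c X} _ hX =>
    ⟨fun k => (IsSelfAdjoint.all c).smul (hX.1 k), fun k j => ?_⟩⟩
  · rw [Matrix.add_apply, Matrix.add_apply, star_add, ← hX.2, ← hY.2]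
  · rw [Matrix.smul_apply, Matrix.smul_apply, star_smul, star_trivial, ← hX.2]

lemma isConic_pptCone : IsConic (pptCone d H) := by
  refine ⟨⟨isConic_posCone.zero_mem, ?_⟩, fun {X Y} hX hY =>
    ⟨isConic_posCone.add_mem hX.1 hY.1, ?_⟩, fun {c X} hc hX =>
    ⟨isConic_posCone.smul_mem hc hX.1, ?_⟩⟩
  · rw [Matrix.transpose_zero]; exact isConic_posCone.zero_mem
  · rw [Matrix.transpose_add]; exact isConic_posCone.add_mem hX.2 hY.2
  · rw [Matrix.transpose_smul]; exact isConic_posCone.smul_mem hc hX.2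

lemma isConic_spaceBρ'' {ρ : H →L[ℂ] H} (hρ : IsTraceSA ρ) :
    IsConic (spaceBρ'' (d := d) ρ) := by
  simp only [spaceBρ'', blockTrace_mul_tens_antisymUnit hρ, ← traceLM_apply hρ]
  refine ⟨⟨isConic_spaceB''.zero_mem, fun i j => by simp⟩, fun {X Y} hX hY =>
    ⟨isConic_spaceB''.add_mem hX.1 hY.1, fun i j => ?_⟩, fun {c X} hc hX =>
    ⟨isConic_spaceB''.smul_mem hc hX.1, fun i j => ?_⟩⟩
  · have h1 := hX.2 i j
    have h2 := hY.2 i j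
    rw [Matrix.add_apply, Matrix.add_apply, map_add, map_add]
    linear_combination h1 + h2
  · have h1 := hX.2 i j
    rw [Matrix.smul_apply, Matrix.smul_apply, ← Complex.coe_smul, ← Complex.coe_smul, map_smul,
      map_smul, ← smul_sub, h1, smul_zero]

/-! ### Product operators -/

/-- Each rank-one summand of the matrix factor contracts `v` to one vector of `H`, which reduces
positivity of `T ⊗ M` to that of `M`. -/
lemma quadForm_tens_sum {m : ℕ} (u : Fin m → Fin (d + 1) → ℝ) (M : H →L[ℂ] H)
    (v : Fin (d + 1) → H) :
    quadForm (tens (∑ i, Matrix.vecMulVec (u i) (star (u i))) M) v =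
      ∑ i, inner ℂ (∑ k, u i k • v k) (M (∑ k, u i k • v k)) := by
  have h : ∀ i, inner ℂ (∑ k, u i k • v k) (M (∑ k, u i k • v k)) =
      ∑ k, ∑ j, ((u i k * u i j : ℝ) : ℂ) * inner ℂ (v k) (M (v j)) := by
    intro i
    rw [sum_inner]
    refine Finset.sum_congr rfl fun k _ => ?_
    rw [map_sum, inner_sum]
    refine Finset.sum_congr rfl fun j _ => ?_
    rw [← Complex.coe_smul, ← Complex.coe_smul (u i j), map_smul, inner_smul_left,
      inner_smul_right, Complex.conj_ofReal]
    push_cast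
    ring
  simp only [h, quadForm, tens_apply, Matrix.sum_apply, Matrix.vecMulVec_apply, smul_apply,
    star_trivial, inner_smul_right_eq_smul, Complex.real_smul, Complex.ofReal_sum,
    Finset.sum_mul]
  exact (Finset.sum_comm.trans (Finset.sum_congr rfl fun k _ => Finset.sum_comm)).symm

lemma tens_mem_spaceB {T : Matrix (Fin (d + 1)) (Fin (d + 1)) ℝ} {M : H →L[ℂ] H}
    (hT : T.PosSemidef) (hM : M.IsPositive) : tens T M ∈ spaceB d H := by
  intro k j
  refine ⟨(IsSelfAdjoint.all (T k j)).smul hM.isSelfAdjoint, ?_⟩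
  rw [tens_apply, tens_apply]
  congr 1
  simpa using (hT.1.apply k j).symm

lemma mem_spaceB''_of_mem_spaceB {X : BlockOp d H} (hX : X ∈ spaceB d H) : X ∈ spaceB'' d H :=
  ⟨fun k => (hX k 0).1, fun k j => by rw [(hX j k).1.star_eq, (hX k j).2]⟩

lemma isHermitian_of_mem_spaceB'' {X : BlockOp d H} (hX : X ∈ spaceB'' d H) : X.IsHermitian :=
  Matrix.IsHermitian.ext fun k j => (hX.2 k j).symm

lemma tens_mem_posCone {T : Matrix (Fin (d + 1)) (Fin (d + 1)) ℝ} {M : H →L[ℂ] H}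
    (hT : T.PosSemidef) (hM : M.IsPositive) : tens T M ∈ posCone d H := by
  refine ⟨isHermitian_of_mem_spaceB'' (mem_spaceB''_of_mem_spaceB (tens_mem_spaceB hT hM)),
    fun v => ?_⟩
  obtain ⟨m, u, rfl⟩ := Matrix.posSemidef_iff_eq_sum_vecMulVec.1 hT
  rw [quadForm_tens_sum, Complex.re_sum]
  exact Finset.sum_nonneg fun i _ => hM.re_inner_nonneg_right _

/-! ### Compressions to finite-dimensional subspaces -/

/-- `(1 ⊗ P) X (1 ⊗ P)`, where `P` projects onto the span of finitely many basis vectors. -/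
def compress (F : Finset (exists_hilbertBasis ℂ H).choose) : BlockOp d H →ₗ[ℝ] BlockOp d H where
  toFun X := Matrix.of fun k j => proj F * X k j * proj F
  map_add' X Y := by ext1 k j; simp [mul_add, add_mul]
  map_smul' c X := by ext1 k j; simp

lemma compress_apply (F : Finset (exists_hilbertBasis ℂ H).choose) (X : BlockOp d H)
    (k j : Fin (d + 1)) : compress F X k j = proj F * X k j * proj F := rfl

lemma star_proj_mul_mul_proj (F : Finset (exists_hilbertBasis ℂ H).choose) (N : H →L[ℂ] H) :
    star (proj F * N * proj F) = proj F * star N * proj F := by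
  rw [star_mul, star_mul, star_proj, mul_assoc]

section Compress

variable (F : Finset (exists_hilbertBasis ℂ H).choose)

lemma compress_mem_posCone {X : BlockOp d H} (hX : X ∈ posCone d H) :
    compress F X ∈ posCone d H := by
  refine ⟨Matrix.IsHermitian.ext fun k j => ?_, fun v => ?_⟩
  · rw [compress_apply, compress_apply, star_proj_mul_mul_proj, hX.1.apply]
  · have e : quadForm (compress F X) v = quadForm X fun k => proj F (v k) := by
      simp only [quadForm, compress_apply, mul_apply_eq_comp, inner_proj_left]
    rw [e]
    exact hX.2 _

lemma compress_mem_pptCone {X : BlockOp d H} (hX : X ∈ pptCone d H) :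
    compress F X ∈ pptCone d H :=
  ⟨compress_mem_posCone F hX.1, compress_mem_posCone F hX.2⟩

lemma compress_mem_spaceB {X : BlockOp d H} (hX : X ∈ spaceB d H) :
    compress F X ∈ spaceB d H := fun k j =>
  ⟨isSelfAdjoint_proj_mul_mul_proj F (hX k j).1, by
    rw [compress_apply, compress_apply, (hX k j).2]⟩

lemma compress_mem_spaceB'' {X : BlockOp d H} (hX : X ∈ spaceB'' d H) :
    compress F X ∈ spaceB'' d H :=
  ⟨fun k => isSelfAdjoint_proj_mul_mul_proj F (hX.1 k), fun k j => by
    rw [compress_apply, compress_apply, star_proj_mul_mul_proj, ← hX.2]⟩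

lemma compress_tens (T : Matrix (Fin (d + 1)) (Fin (d + 1)) ℝ) (M : H →L[ℂ] H) :
    compress F (tens T M) = tens T (proj F * M * proj F) := by
  ext1 k j
  rw [compress_apply, tens_apply, tens_apply, mul_smul_comm, smul_mul_assoc]

lemma compress_mem_sepCone {X : BlockOp d H} (hX : X ∈ sepCone d H) :
    compress F X ∈ sepCone d H := by
  have h : compress F X ∈ compress F '' sepCone d H := ⟨X, hX, rfl⟩
  rw [sepCone, LinearMap.image_convexHull] at h
  refine convexHull_mono ?_ h
  rintro _ ⟨_, ⟨T, M, hT, hM, rfl⟩, rfl⟩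
  refine ⟨T, proj F * M * proj F, hT, ?_, compress_tens F T M⟩
  have := hM.conj_adjoint (proj F)
  rwa [← ContinuousLinearMap.star_eq_adjoint, star_proj] at this

end Compress

/-! ### The cones of the five programs -/

/-- The block operator `∑ i j, w i j |i⟩⟨j| ⊗ 1`, with `i`, `j` among `1, …, d`. -/
def scalarBlock (w : Fin d → Fin d → ℂ) : BlockOp d H :=
  Matrix.of fun k j => Fin.cases 0 (fun i => Fin.cases 0 (fun l => w i l • 1) j) k

@[simp] lemma scalarBlock_zero_left (w : Fin d → Fin d → ℂ) (j : Fin (d + 1)) :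
    (scalarBlock w : BlockOp d H) 0 j = 0 := rfl

@[simp] lemma scalarBlock_zero_right (w : Fin d → Fin d → ℂ) (k : Fin (d + 1)) :
    (scalarBlock w : BlockOp d H) k 0 = 0 := by
  cases k using Fin.cases <;> rfl

@[simp] lemma scalarBlock_succ_succ (w : Fin d → Fin d → ℂ) (i j : Fin d) :
    (scalarBlock w : BlockOp d H) i.succ j.succ = w i j • 1 := rfl

lemma scalarBlock_zero : (scalarBlock 0 : BlockOp d H) = 0 := by
  ext1 k j
  cases k using Fin.cases <;> cases j using Fin.cases <;> simp

/-- The properties of the cones on which the duality argument rests. -/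
structure IsAdmissible (K : Set (BlockOp d H)) : Prop where
  isConic : IsConic K
  tens_mem : ∀ {T : Matrix (Fin (d + 1)) (Fin (d + 1)) ℝ} {M : H →L[ℂ] H},
    T.PosSemidef → M.IsPositive → tens T M ∈ K
  mem_posCone : ∀ {X}, X ∈ K → X ∈ posCone d H
  mem_spaceB'' : ∀ {X}, X ∈ K → X ∈ spaceB'' d H
  exists_approx : ∀ {X}, X ∈ K →
    ∃ w : Finset (exists_hilbertBasis ℂ H).choose → Fin d → Fin d → ℂ,
      (∀ i j, Tendsto (fun F => w F i j) atTop (𝓝 0)) ∧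
        ∀ F, compress F X + scalarBlock (w F) ∈ K

lemma exists_approx_of_compress_mem {K : Set (BlockOp d H)} {X : BlockOp d H}
    (h : ∀ F, compress F X ∈ K) :
    ∃ w : Finset (exists_hilbertBasis ℂ H).choose → Fin d → Fin d → ℂ,
      (∀ i j, Tendsto (fun F => w F i j) atTop (𝓝 0)) ∧
        ∀ F, compress F X + scalarBlock (w F) ∈ K :=
  ⟨fun _ => 0, fun _ _ => tendsto_const_nhds, fun F => by
    rw [scalarBlock_zero, add_zero]; exact h F⟩

lemma isAdmissible_pos_inter_spaceB : IsAdmissible (posCone d H ∩ spaceB d H) where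
  isConic := isConic_posCone.inter isConic_spaceB
  tens_mem hT hM := ⟨tens_mem_posCone hT hM, tens_mem_spaceB hT hM⟩
  mem_posCone hX := hX.1
  mem_spaceB'' hX := mem_spaceB''_of_mem_spaceB hX.2
  exists_approx hX := exists_approx_of_compress_mem fun F =>
    ⟨compress_mem_posCone F hX.1, compress_mem_spaceB F hX.2⟩

lemma isAdmissible_sepCone : IsAdmissible (sepCone d H) := by
  have hsub : sepCone d H ⊆ posCone d H ∩ spaceB d H := by
    refine convexHull_min ?_ isAdmissible_pos_inter_spaceB.isConic.convex
    rintro _ ⟨T, M, hT, hM, rfl⟩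
    exact isAdmissible_pos_inter_spaceB.tens_mem hT hM
  refine ⟨isConic_convexHull ⟨0, 0, Matrix.PosSemidef.zero, ContinuousLinearMap.isPositive_zero, ?_⟩
    ?_, fun hT hM => subset_convexHull ℝ _ ⟨_, _, hT, hM, rfl⟩, fun hX => (hsub hX).1,
    fun hX => mem_spaceB''_of_mem_spaceB (hsub hX).2,
    fun hX => exists_approx_of_compress_mem fun F => compress_mem_sepCone F hX⟩
  · ext1 k j
    simp [tens_apply]
  · rintro c _ hc ⟨T, M, hT, hM, rfl⟩
    refine ⟨c • T, M, hT.smul hc, hM, ?_⟩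
    ext1 k j
    simp [tens_apply, smul_smul]

lemma isAdmissible_ppt_inter_spaceB'' : IsAdmissible (pptCone d H ∩ spaceB'' d H) where
  isConic := isConic_pptCone.inter isConic_spaceB''
  tens_mem {T M} hT hM := by
    have h := tens_mem_spaceB hT hM
    have ht : (tens T M : BlockOp d H).transpose = tens T M := by
      ext1 k j
      exact (h j k).2
    refine ⟨⟨tens_mem_posCone hT hM, ?_⟩, mem_spaceB''_of_mem_spaceB h⟩
    rw [ht]
    exact tens_mem_posCone hT hM
  mem_posCone hX := hX.1.1
  mem_spaceB'' hX := hX.2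
  exists_approx hX := exists_approx_of_compress_mem fun F =>
    ⟨compress_mem_pptCone F hX.1, compress_mem_spaceB'' F hX.2⟩

lemma isAdmissible_pos_inter_spaceB'' : IsAdmissible (posCone d H ∩ spaceB'' d H) where
  isConic := isConic_posCone.inter isConic_spaceB''
  tens_mem hT hM :=
    ⟨tens_mem_posCone hT hM, mem_spaceB''_of_mem_spaceB (tens_mem_spaceB hT hM)⟩
  mem_posCone hX := hX.1
  mem_spaceB'' hX := hX.2
  exists_approx hX := exists_approx_of_compress_mem fun F =>
    ⟨compress_mem_posCone F hX.1, compress_mem_spaceB'' F hX.2⟩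

/-- The matrix `-i t + (∑ |t|) 1`. -/
def antisymShift (t : Fin d → Fin d → ℝ) (i j : Fin d) : ℂ :=
  -Complex.I * t i j + if i = j then ((∑ k, ∑ l, |t k l| : ℝ) : ℂ) else 0

lemma antisymShift_im (t : Fin d → Fin d → ℝ) (i j : Fin d) :
    (antisymShift t i j).im = -t i j := by
  unfold antisymShift
  split_ifs <;> simp

lemma star_antisymShift {t : Fin d → Fin d → ℝ} (ht : ∀ i j, t j i = -t i j) (i j : Fin d) :
    star (antisymShift t j i) = antisymShift t i j := by
  unfold antisymShift
  rw [ht i j]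
  by_cases h : i = j
  · subst h; simp [-Complex.ofReal_sum]
  · simp [h, Ne.symm h]

lemma scalarBlock_antisymShift_mem_spaceB'' {t : Fin d → Fin d → ℝ} (ht : ∀ i j, t j i = -t i j) :
    (scalarBlock (antisymShift t) : BlockOp d H) ∈ spaceB'' d H := by
  refine ⟨fun k => by simp, fun k j => ?_⟩
  cases k using Fin.cases <;> cases j using Fin.cases <;> simp [star_smul]
  rename_i i j
  rw [← star_antisymShift ht i j]
  rfl

/-- With `N = ∑ ‖v i‖²` over the indices `1, …, d`, each entry of `-i t` costs at most `|t i j| N`,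
and the diagonal shift contributes exactly `(∑ |t|) N`. -/
lemma scalarBlock_antisymShift_mem_posCone {t : Fin d → Fin d → ℝ} (ht : ∀ i j, t j i = -t i j) :
    (scalarBlock (antisymShift t) : BlockOp d H) ∈ posCone d H := by
  refine ⟨isHermitian_of_mem_spaceB'' (scalarBlock_antisymShift_mem_spaceB'' ht), fun v => ?_⟩
  have e : quadForm (scalarBlock (antisymShift t)) v =
      ∑ i : Fin d, ∑ j : Fin d, antisymShift t i j * inner ℂ (v i.succ) (v j.succ) := by
    simp [quadForm, Fin.sum_univ_succ]
  set N := ∑ i : Fin d, ‖v i.succ‖ ^ 2 with hN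
  have hle : ∀ i : Fin d, ‖v i.succ‖ ^ 2 ≤ N := fun i =>
    Finset.single_le_sum (f := fun i : Fin d => ‖v i.succ‖ ^ 2) (fun _ _ => sq_nonneg _)
      (Finset.mem_univ i)
  have hterm : ∀ i j : Fin d, -(|t i j| * N) +
      (if i = j then (∑ k, ∑ l, |t k l|) * ‖v i.succ‖ ^ 2 else 0) ≤
      (antisymShift t i j * inner ℂ (v i.succ) (v j.succ)).re := by
    intro i j
    have h1 : (-Complex.I * t i j * inner ℂ (v i.succ) (v j.succ)).re =
        t i j * (inner ℂ (v i.succ) (v j.succ)).im := by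
      simp [mul_assoc]
    have h2 : -(|t i j| * N) ≤ t i j * (inner ℂ (v i.succ) (v j.succ)).im := by
      refine (neg_le_neg ?_).trans (neg_abs_le _)
      rw [abs_mul]
      refine mul_le_mul_of_nonneg_left ?_ (abs_nonneg _)
      refine (Complex.abs_im_le_norm _).trans ((norm_inner_le_norm _ _).trans ?_)
      nlinarith [hle i, hle j, sq_nonneg (‖v i.succ‖ - ‖v j.succ‖)]
    rw [antisymShift, add_mul, Complex.add_re, h1]
    refine add_le_add h2 (le_of_eq ?_)
    split_ifs with h
    · subst h
      rw [Complex.re_ofReal_mul, ← RCLike.re_eq_complex_re, inner_self_eq_norm_sq]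
    · simp
  rw [e, Complex.re_sum]
  simp only [Complex.re_sum]
  refine le_trans (le_of_eq ?_)
    (Finset.sum_le_sum fun i _ => Finset.sum_le_sum fun j _ => hterm i j)
  simp only [Finset.sum_add_distrib, Finset.sum_neg_distrib, Finset.sum_ite_eq, Finset.mem_univ,
    if_true, ← Finset.sum_mul, ← Finset.mul_sum]
  rw [← hN]
  ring

/-- Within `ℬ''` the extra condition says that each `Tr(ρ X_ij)`, `1 ≤ i, j ≤ d`, is real.
Compression may create imaginary parts `t F i j`, which tend to `0` because the trace against `ρ` is
normal. Adding `antisymShift (t F)` cancels them exactly since `Tr ρ = 1`, and its diagonal part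
preserves positivity. -/
lemma isAdmissible_pos_inter_spaceBρ'' {ρ : H →L[ℂ] H} (hρ : IsTraceSA ρ) (hρ1 : opTrace ρ = 1) :
    IsAdmissible (posCone d H ∩ spaceBρ'' ρ) where
  isConic := isConic_posCone.inter (isConic_spaceBρ'' hρ)
  tens_mem {T M} hT hM := by
    have h := tens_mem_spaceB hT hM
    refine ⟨tens_mem_posCone hT hM, mem_spaceB''_of_mem_spaceB h, fun i j => ?_⟩
    rw [blockTrace_mul_tens_antisymUnit hρ, (h i.succ j.succ).2, sub_self]
  mem_posCone hX := hX.1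
  mem_spaceB'' hX := hX.2.1
  exists_approx {X} hX := by
    have hstar : ∀ {Y : BlockOp d H}, Y ∈ spaceB'' d H → ∀ i j : Fin d,
        opTrace (ρ * Y j.succ i.succ) = star (opTrace (ρ * Y i.succ j.succ)) := by
      intro Y hY i j
      rw [hY.2 j.succ i.succ, hρ.opTrace_mul_star]
    let t : Finset (exists_hilbertBasis ℂ H).choose → Fin d → Fin d → ℝ := fun F i j =>
      (opTrace (ρ * compress F X i.succ j.succ)).im
    have ht : ∀ F i j, t F j i = -t F i j := fun F i j => by
      simp only [t]
      rw [hstar (compress_mem_spaceB'' F hX.2.1) i j]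
      rfl
    have ht0 : ∀ i j, Tendsto (fun F => t F i j) atTop (𝓝 0) := by
      intro i j
      have h0 : (opTrace (ρ * X i.succ j.succ)).im = 0 := by
        have h := hX.2.2 i j
        rw [blockTrace_mul_tens_antisymUnit hρ, hstar hX.2.1 i j, sub_eq_zero] at h
        exact Complex.conj_eq_iff_im.1 h.symm
      rw [← h0]
      exact (Complex.continuous_im.tendsto _).comp (hρ.tendsto_opTrace_mul _)
    refine ⟨fun F => antisymShift (t F), fun i j => ?_, fun F => ⟨?_, ?_, fun i j => ?_⟩⟩
    · have h1 : Tendsto (fun F => -Complex.I * (t F i j : ℂ)) atTop (𝓝 0) := by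
        have := ((Complex.continuous_ofReal.tendsto _).comp (ht0 i j)).const_mul (-Complex.I)
        simpa using this
      have h2 : Tendsto (fun F => ((∑ k, ∑ l, |t F k l| : ℝ) : ℂ)) atTop (𝓝 0) := by
        have h3 : Tendsto (fun F => ∑ k, ∑ l, |t F k l|) atTop (𝓝 (∑ k : Fin d, ∑ l : Fin d, |0|)) :=
          tendsto_finsetSum _ fun k _ => tendsto_finsetSum _ fun l _ => (ht0 k l).abs
        have := (Complex.continuous_ofReal.tendsto _).comp h3
        simpa [Function.comp_def] using this
      by_cases hij : i = j
      · simpa only [antisymShift, if_pos hij, add_zero] using h1.add h2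
      · simpa only [antisymShift, if_neg hij, add_zero] using h1
    · exact isConic_posCone.add_mem (compress_mem_posCone F hX.1)
        (scalarBlock_antisymShift_mem_posCone (ht F))
    · exact isConic_spaceB''.add_mem (compress_mem_spaceB'' F hX.2.1)
        (scalarBlock_antisymShift_mem_spaceB'' (ht F))
    · have hY := isConic_spaceB''.add_mem (compress_mem_spaceB'' F hX.2.1)
        (scalarBlock_antisymShift_mem_spaceB'' (H := H) (ht F))
      rw [blockTrace_mul_tens_antisymUnit hρ, hstar hY i j, sub_eq_zero]
      refine (Complex.conj_eq_iff_im.2 ?_).symm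
      rw [Matrix.add_apply, hρ.opTrace_mul_add, scalarBlock_succ_succ, mul_smul_comm, opTrace_smul,
        mul_one, hρ1, mul_one, Complex.add_im, antisymShift_im]
      exact add_neg_cancel _

theorem isAdmissible_cone {ρ : H →L[ℂ] H} (hρ : IsTraceSA ρ) (hρ1 : opTrace ρ = 1) (l : Fin 5) :
    IsAdmissible (cone d ρ l) := by
  fin_cases l
  · exact isAdmissible_sepCone
  · exact isAdmissible_pos_inter_spaceB
  · exact isAdmissible_ppt_inter_spaceB''
  · exact isAdmissible_pos_inter_spaceB''
  · exact isAdmissible_pos_inter_spaceBρ'' hρ hρ1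

/-! ### Strict feasibility -/

lemma posSemidef_single_zero :
    (Matrix.single 0 0 1 : Matrix (Fin (d + 1)) (Fin (d + 1)) ℝ).PosSemidef := by
  have := Matrix.posSemidef_vecMulVec_self_star (Pi.single 0 1 : Fin (d + 1) → ℝ)
  rwa [star_trivial, ← Matrix.single_eq_single_vecMulVec_single] at this

/-- Take the vectors `u = |0⟩ ± s |i⟩` and the sum of `u uᵀ ⊗ (‖B‖ ± B) / (2 s)` over both signs.
Large `s` makes the `(0, 0)` block small while the `(0, i)` block stays `B`; the unconstrained `(i,
i)` block absorbs the growth. -/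
lemma exists_mem_of_single {K : Set (BlockOp d H)} (hK : IsAdmissible K) (i : Fin d)
    {B : H →L[ℂ] H} (hB : IsSelfAdjoint B) {s : ℝ} (hs : 0 < s) :
    ∃ X ∈ K, X 0 0 = (‖B‖ / s) • (1 : H →L[ℂ] H) ∧
      ∀ j : Fin d, X 0 j.succ = if j = i then B else 0 := by
  have h1 : 0 ≤ ‖B‖ • (1 : H →L[ℂ] H) + B := by
    have := hB.neg_algebraMap_norm_le_self
    rwa [Algebra.algebraMap_eq_smul_one, neg_le_iff_add_nonneg, add_comm] at this
  have h2 : 0 ≤ ‖B‖ • (1 : H →L[ℂ] H) - B := by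
    have := hB.le_algebraMap_norm_self
    rwa [Algebra.algebraMap_eq_smul_one, ← sub_nonneg] at this
  have hpos : ∀ {A : H →L[ℂ] H}, 0 ≤ A → ((2 * s)⁻¹ • A).IsPositive := fun hA =>
    (ContinuousLinearMap.nonneg_iff_isPositive _).1 (smul_nonneg (by positivity) hA)
  let u : ℝ → Fin (d + 1) → ℝ := fun r => Fin.cons 1 (Pi.single i r)
  have hu : ∀ r, (Matrix.vecMulVec (u r) (u r)).PosSemidef := fun r => by
    simpa using Matrix.posSemidef_vecMulVec_self_star (u r)
  refine ⟨_, hK.isConic.add_mem (hK.tens_mem (hu s) (hpos h1)) (hK.tens_mem (hu (-s)) (hpos h2)),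
    ?_, fun j => ?_⟩
  · simp only [Matrix.add_apply, tens_apply, Matrix.vecMulVec_apply, u, Fin.cons_zero, mul_one,
      ← smul_add, add_add_sub_cancel, ← two_smul ℝ, smul_smul]
    congr 1
    field_simp
  · simp only [Matrix.add_apply, tens_apply, Matrix.vecMulVec_apply, u, Fin.cons_zero,
      Fin.cons_succ, one_mul]
    split_ifs with h
    · subst h
      have : s * (2 * s)⁻¹ = 1 / 2 := by field_simp
      rw [Pi.single_eq_same, Pi.single_eq_same, smul_smul, smul_smul, neg_mul, this]
      module
    · simp [Pi.single_eq_of_ne h]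

lemma exists_mem_of_blocks {K : Set (BlockOp d H)} (hK : IsAdmissible K)
    {B : Fin d → H →L[ℂ] H} (hB : ∀ i, IsSelfAdjoint (B i)) {N : H →L[ℂ] H} (hN : 1 ≤ N) :
    ∃ X ∈ K, X 0 0 = N ∧ ∀ j : Fin d, X 0 j.succ = B j := by
  set c := ∑ i, ‖B i‖ with hc
  have hc0 : 0 ≤ c := Finset.sum_nonneg fun i _ => norm_nonneg _
  -- With `s = c + 1`, positive even if all `B i` vanish, the `(0, 0)` blocks add up to `c / (c + 1)
  -- ≤ 1 ≤ N`. The deficit is filled by a positive operator at `|0⟩⟨0|`.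
  choose Z hZK hZ0 hZ using fun i =>
    exists_mem_of_single hK i (hB i) (add_pos_of_nonneg_of_pos hc0 one_pos)
  have hle : c / (c + 1) ≤ 1 := div_le_one_of_le₀ (by linarith) (by linarith)
  have hM : (N - (c / (c + 1)) • (1 : H →L[ℂ] H)).IsPositive := by
    rw [← ContinuousLinearMap.nonneg_iff_isPositive]
    have : N - (c / (c + 1)) • (1 : H →L[ℂ] H) = (N - 1) + (1 - c / (c + 1)) • 1 := by
      rw [sub_smul, one_smul]; abel
    rw [this]
    exact add_nonneg (sub_nonneg.2 hN) (smul_nonneg (sub_nonneg.2 hle) zero_le_one)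
  refine ⟨_, hK.isConic.add_mem (hK.tens_mem posSemidef_single_zero hM)
    (hK.isConic.sum_mem Finset.univ Z fun i _ => hZK i), ?_, fun j => ?_⟩
  · simp only [Matrix.add_apply, tens_apply, Matrix.sum_apply, hZ0, Matrix.single_apply_same,
      one_smul, ← Finset.sum_smul, ← Finset.sum_div]
    rw [← hc]
    abel
  · simp [tens_apply, Matrix.sum_apply, hZ, (Fin.succ_ne_zero _).symm]

/-! ### Strong duality -/

lemma traceTens_symUnit_of_mem {D : H →L[ℂ] H} (hD : IsTraceSA D) (i : Fin d) {X : BlockOp d H}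
    (hX : X ∈ spaceB'' d H) : traceTens (symUnit i) hD X = (opTrace (D * X 0 i.succ)).re := by
  rw [traceTens_apply, blockTrace_tens_symUnit_mul_of_mem hD i hX, Complex.ofReal_re]

/-- Writing `G` as a sum of `u uᵀ` contracts `X` to positive operators on `H`, whose traces against
`ρ` have nonnegative real part. -/
lemma traceTens_extend_nonneg {ρ : H →L[ℂ] H} (hρ : 0 ≤ ρ) (hρt : IsTraceSA ρ)
    {G : Matrix (Fin d) (Fin d) ℝ} (hG : G.PosSemidef) {X : BlockOp d H} (hX : X ∈ posCone d H) :
    0 ≤ traceTens (extend G) hρt X := by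
  obtain ⟨m, u, rfl⟩ := Matrix.posSemidef_iff_eq_sum_vecMulVec.1 hG
  have hpos : ∀ r, 0 ≤ ∑ i : Fin d, ∑ j : Fin d, (u r i * u r j) • X j.succ i.succ := by
    intro r
    rw [ContinuousLinearMap.nonneg_iff_isPositive, ContinuousLinearMap.isPositive_def']
    constructor
    · rw [IsSelfAdjoint, star_sum, Finset.sum_comm]
      refine Finset.sum_congr rfl fun i _ => ?_
      rw [star_sum]
      refine Finset.sum_congr rfl fun j _ => ?_
      rw [star_smul, hX.1.apply, star_trivial, mul_comm]
    · intro x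
      have h := hX.2 (Fin.cons 0 fun i => u r i • x)
      rw [ContinuousLinearMap.reApplyInnerSelf_apply, ← inner_conj_symm, RCLike.conj_re]
      refine h.trans (le_of_eq ?_)
      rw [RCLike.re_eq_complex_re]
      congr 1
      simp only [quadForm, Fin.sum_univ_succ, Fin.cons_zero, Fin.cons_succ, inner_zero_left,
        map_zero, inner_zero_right, Finset.sum_const_zero, zero_add, sum_apply, inner_sum]
      rw [Finset.sum_comm]
      refine Finset.sum_congr rfl fun i _ => Finset.sum_congr rfl fun j _ => ?_
      rw [← Complex.coe_smul, ← Complex.coe_smul, map_smul, inner_smul_left, inner_smul_right,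
        Complex.conj_ofReal, smul_apply, ← Complex.coe_smul, inner_smul_right]
      push_cast
      ring
  have e : blockTrace (tens (extend (∑ r, Matrix.vecMulVec (u r) (star (u r)))) ρ * X) =
      ∑ r, opTrace (ρ * ∑ i : Fin d, ∑ j : Fin d, (u r i * u r j) • X j.succ i.succ) := by
    rw [blockTrace_tens_extend_mul hρt]
    simp only [← traceLM_apply hρt, map_sum, ← Complex.coe_smul, map_smul, Matrix.sum_apply,
      Matrix.vecMulVec_apply, star_trivial, Complex.ofReal_sum, Finset.sum_mul, smul_eq_mul]
    exact ((Finset.sum_comm.trans (Finset.sum_congr rfl fun k _ => Finset.sum_comm))).symm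
  rw [traceTens_apply, e, Complex.re_sum]
  exact Finset.sum_nonneg fun r _ => re_opTrace_mul_nonneg hρ hρt.2 (hpos r)

lemma re_inner_apply_zero_zero_nonneg {X : BlockOp d H} (hX : X ∈ posCone d H) (x : H) :
    0 ≤ (inner ℂ x (X 0 0 x)).re := by
  have h := hX.2 (Fin.cons x fun _ => 0)
  simpa [quadForm, Fin.sum_univ_succ] using h

lemma exists_mem_of_constraints {K : Set (BlockOp d H)} (hK : IsAdmissible K)
    {D : Fin d → H →L[ℂ] H} (hD : ∀ j, IsTraceSA (D j)) (hli : LinearIndependent ℝ D)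
    (m : Matrix (Fin d) (Fin d) ℝ) {N : H →L[ℂ] H} (hN : 1 ≤ N) :
    ∃ X ∈ K, X 0 0 = N ∧ ∀ i j, traceTens (symUnit i) (hD j) X = m i j := by
  choose B hB hBm using fun i => exists_dual_operators D hD hli (m i)
  obtain ⟨X, hX, h0, h1⟩ := exists_mem_of_blocks hK hB hN
  refine ⟨X, hX, h0, fun i j => ?_⟩
  rw [traceTens_symUnit_of_mem (hD j) i (hK.mem_spaceB'' hX), h1, hBm]

lemma mem_primalFeasible_iff {K : Set (BlockOp d H)} (hK : IsAdmissible K)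
    {D : Fin d → H →L[ℂ] H} (hD : ∀ j, IsTraceSA (D j)) {X : BlockOp d H} :
    X ∈ primalFeasible D K ↔ X ∈ K ∧ X 0 0 = 1 ∧
      ∀ i j, traceTens (symUnit i) (hD j) X = (1 : Matrix (Fin d) (Fin d) ℝ) i j := by
  rw [primalFeasible, Set.mem_ofPred_eq, trace_tens_single_mul]
  refine and_congr_right fun hX => and_congr_right fun _ => forall_congr' fun i =>
    forall_congr' fun j => ?_
  have h := blockTrace_tens_symUnit_mul_of_mem (hD j) i (hK.mem_spaceB'' hX)
  rw [traceTens_apply, h, Complex.ofReal_re, Matrix.one_apply]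
  split_ifs <;> norm_cast

lemma weak_duality {K : Set (BlockOp d H)} (hK : IsAdmissible K) {G : Matrix (Fin d) (Fin d) ℝ}
    {ρ : H →L[ℂ] H} (hρ : IsTraceSA ρ) {D : Fin d → H →L[ℂ] H} (hD : ∀ j, IsTraceSA (D j)) :
    dualValue G ρ D K ≤ primalValue G ρ D K := by
  refine iSup₂_le fun p hp => le_iInf₂ fun X hX => ?_
  rw [EReal.coe_le_coe_iff]
  obtain ⟨hXK, h0, hc⟩ := (mem_primalFeasible_iff hK hD).1 hX
  have h := hp.2.2.2 X hXK
  rw [re_blockTrace_dualOp_mul hρ hD ⟨hp.1, hp.2.1⟩, h0, mul_one] at h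
  simp only [hc, Matrix.one_apply, mul_ite, mul_one, mul_zero, Finset.sum_ite_eq, Finset.mem_univ,
    if_true] at h
  rw [traceTens_apply] at h
  simp only [Matrix.trace, Matrix.diag_apply]
  linarith

/-- Replaces the possibly singular multiplier `φ` by minus the normal part of `-φ`, losing neither
the dual objective nor dual feasibility. -/
lemma exists_normal_multiplier {K : Set (BlockOp d H)} (hK : IsAdmissible K)
    {G : Matrix (Fin d) (Fin d) ℝ} {ρ : H →L[ℂ] H} (hρ : IsTraceSA ρ) {D : Fin d → H →L[ℂ] H}
    (hD : ∀ j, IsTraceSA (D j)) (a : Matrix (Fin d) (Fin d) ℝ)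
    (φ : selfAdjoint (H →L[ℂ] H) →ₗ[ℝ] ℝ)
    (hφ : ∀ X ∈ K, ∑ i, ∑ j, a i j * traceTens (symUnit i) (hD j) X + φ (realPart (X 0 0)) ≤
      traceTens (extend G) hρ X) :
    ∃ S : H →L[ℂ] H, IsTraceSA S ∧ φ 1 ≤ (opTrace S).re ∧
      ∀ X ∈ K, 0 ≤ (blockTrace (dualOp G ρ D a S * X)).re := by
  -- On `|0⟩⟨0| ⊗ M` the objective and the `D j` constraints vanish, leaving `φ M ≤ 0`.
  have hneg : ∀ M : selfAdjoint (H →L[ℂ] H), 0 ≤ M.1 → 0 ≤ (-φ) M := by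
    intro M hM
    have hmem := hK.tens_mem posSemidef_single_zero ((ContinuousLinearMap.nonneg_iff_isPositive _).1 hM)
    have h := hφ _ hmem
    have h1 : ∀ i j : Fin d, traceTens (symUnit i) (hD j) (tens (Matrix.single 0 0 1) M.1) = 0 := by
      intro i j
      rw [traceTens_symUnit_of_mem (hD j) i (hK.mem_spaceB'' hmem)]
      simp [tens_apply, (Fin.succ_ne_zero _).symm]
    have h2 : traceTens (extend G) hρ (tens (Matrix.single 0 0 1) M.1) = 0 := by
      rw [traceTens_apply, blockTrace_tens_extend_mul hρ]
      simp [tens_apply, (Fin.succ_ne_zero _).symm]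
    have h3 : realPart ((tens (Matrix.single 0 0 1) M.1 : BlockOp d H) 0 0) = M := by
      ext1
      simp [tens_apply]
    rw [h2, h3] at h
    simp only [h1, mul_zero, Finset.sum_const_zero, zero_add] at h
    simpa using h
  obtain ⟨T, hTt, hT1, hTφ⟩ := exists_normal_part (-φ) hneg
  refine ⟨-T, hTt.neg, ?_, fun X hX => ?_⟩
  · rw [opTrace_neg, Complex.neg_re]
    rw [LinearMap.neg_apply] at hT1
    linarith
  have hXB := hK.mem_spaceB'' hX
  obtain ⟨w, hw, hwK⟩ := hK.exists_approx hX
  rw [re_blockTrace_dualOp_mul hρ hD hTt.neg]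
  -- The correction `scalarBlock (w F)` is invisible to the `D j` and `S` terms and changes the
  -- objective only by multiples of the entries of `w F`, which tend to `0`.
  have hlim : Tendsto (fun F => traceTens (extend G) hρ (compress F X + scalarBlock (w F)) -
      ∑ i, ∑ j, a i j * traceTens (symUnit i) (hD j) (compress F X + scalarBlock (w F)) -
      (opTrace (-T * compress F X 0 0)).re) atTop
      (𝓝 (traceTens (extend G) hρ X - ∑ i, ∑ j, a i j * traceTens (symUnit i) (hD j) X -
        (opTrace (-T * X 0 0)).re)) := by
    refine (Tendsto.sub ?_ (tendsto_finsetSum _ fun i _ => tendsto_finsetSum _ fun j _ => ?_)).sub ?_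
    · simp only [traceTens_apply, blockTrace_tens_extend_mul hρ]
      refine (Complex.continuous_re.tendsto _).comp (tendsto_finsetSum _ fun i _ =>
        tendsto_finsetSum _ fun j _ => Tendsto.const_mul _ ?_)
      have h1 := (hρ.tendsto_opTrace_mul (X j.succ i.succ)).add
        ((hw j i).mul_const (opTrace ρ))
      rw [zero_mul, add_zero] at h1
      refine h1.congr fun F => ?_
      rw [Matrix.add_apply, hρ.opTrace_mul_add, scalarBlock_succ_succ, mul_smul_comm, mul_one,
        opTrace_smul, compress_apply]
    · simp only [traceTens_symUnit_of_mem (hD j) i (hK.mem_spaceB'' (hwK _)),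
        traceTens_symUnit_of_mem (hD j) i hXB, Matrix.add_apply, scalarBlock_zero_left, add_zero,
        compress_apply]
      exact ((Complex.continuous_re.tendsto _).comp
        ((hD j).tendsto_opTrace_mul _)).const_mul _
    · exact (Complex.continuous_re.tendsto _).comp (hTt.neg.tendsto_opTrace_mul _)
  refine ge_of_tendsto' hlim fun F => ?_
  have h := hφ _ (hwK F)
  have h2 := hTφ F ⟨X 0 0, hXB.1 0⟩
  have h3 : realPart ((compress F X + scalarBlock (w F) : BlockOp d H) 0 0) =
      ⟨proj F * X 0 0 * proj F, isSelfAdjoint_proj_mul_mul_proj F (hXB.1 0)⟩ := by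
    ext1
    rw [Matrix.add_apply, scalarBlock_zero_left, add_zero, compress_apply]
    exact (isSelfAdjoint_proj_mul_mul_proj F (hXB.1 0)).coe_realPart
  rw [h3] at h
  rw [LinearMap.neg_apply] at h2
  dsimp only at h2
  rw [neg_mul, opTrace_neg, Complex.neg_re, compress_apply, ← h2]
  linarith

theorem exists_dual_optimal {K : Set (BlockOp d H)} (hK : IsAdmissible K)
    {G : Matrix (Fin d) (Fin d) ℝ} (hG : G.PosSemidef) {ρ : H →L[ℂ] H} (hρ0 : 0 ≤ ρ)
    (hρ : IsTraceSA ρ) {D : Fin d → H →L[ℂ] H} (hD : ∀ j, IsTraceSA (D j))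
    (hli : LinearIndependent ℝ D) [Nontrivial H] {v : ℝ}
    (hv : ∀ X ∈ primalFeasible D K, v ≤ traceTens (extend G) hρ X) :
    ∃ p ∈ dualFeasible G ρ D K, v ≤ p.1.trace + (opTrace p.2).re := by
  let A : BlockOp d H →ₗ[ℝ] Matrix (Fin d) (Fin d) ℝ × selfAdjoint (H →L[ℂ] H) :=
    { toFun := fun X => (Matrix.of fun i j => traceTens (symUnit i) (hD j) X, realPart (X 0 0))
      map_add' := fun X Y => by
        refine Prod.ext ?_ ?_
        · ext i j; simp
        · simp
      map_smul' := fun c X => by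
        refine Prod.ext ?_ ?_
        · ext i j; simp
        · simp }
  have hX0 : ∀ {X}, X ∈ K → ((realPart (X 0 0) : selfAdjoint (H →L[ℂ] H)) : H →L[ℂ] H) = X 0 0 :=
    fun hX => ((hK.mem_spaceB'' hX).1 0).coe_realPart
  -- For `d = 0` the matrix component is trivial, so the right-hand side is nonzero only because `1
  -- ≠ 0` on `H`.
  obtain ⟨x, hx⟩ := exists_ne (0 : H)
  have hb : ((1, 1) : Matrix (Fin d) (Fin d) ℝ × selfAdjoint (H →L[ℂ] H)) ≠ 0 := fun h =>
    hx (by simpa using congrArg (fun p => (p.2 : H →L[ℂ] H) x) h)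
  have hfeas : ∀ X ∈ K, A X = (1, 1) → v ≤ traceTens (extend G) hρ X := by
    intro X hX hXb
    refine hv X ((mem_primalFeasible_iff hK hD).2 ⟨hX, ?_, fun i j => ?_⟩)
    · rw [← hX0 hX]
      exact congrArg (fun p => (p.2 : H →L[ℂ] H)) hXb
    · exact congrFun (congrFun (congrArg Prod.fst hXb) i) j
  have hneg : ∀ X ∈ K, ∀ t : ℝ, A X = t • (1, 1) → 0 ≤ t := by
    intro X hX t hXt
    have h1 : X 0 0 = t • (1 : H →L[ℂ] H) := by
      rw [← hX0 hX]
      exact congrArg (fun p => (p.2 : H →L[ℂ] H)) hXt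
    have h2 := re_inner_apply_zero_zero_nonneg (hK.mem_posCone hX) x
    rw [h1, smul_apply, one_apply_eq_self, inner_smul_right_eq_smul, Complex.smul_re, smul_eq_mul,
      ← RCLike.re_eq_complex_re, inner_self_eq_norm_sq] at h2
    exact nonneg_of_mul_nonneg_left h2 (by positivity)
  have hcore : ∀ e, ∃ t : ℝ, ∃ X ∈ K, A X = e + t • (1, 1) := by
    rintro ⟨m, N⟩
    -- The shift `t = ‖N‖ + 1` lifts the prescribed `(0, 0)` block above `1`, as
    -- `exists_mem_of_constraints` requires; the matrix part is unrestricted.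
    have hN : 1 ≤ N.1 + (‖N.1‖ + 1) • (1 : H →L[ℂ] H) := by
      have := N.2.neg_algebraMap_norm_le_self
      rw [Algebra.algebraMap_eq_smul_one, neg_le_iff_add_nonneg] at this
      rw [add_smul, one_smul, ← add_assoc, le_add_iff_nonneg_left]
      exact this
    obtain ⟨X, hX, h0, h1⟩ := exists_mem_of_constraints hK hD hli
      (m + (‖N.1‖ + 1) • (1 : Matrix (Fin d) (Fin d) ℝ)) hN
    refine ⟨‖N.1‖ + 1, X, hX, Prod.ext ?_ ?_⟩
    · ext i j
      exact h1 i j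
    · ext1
      exact (hX0 hX).trans h0
  obtain ⟨φ, hφb, hφ⟩ := exists_dual_functional hK.isConic.toPointedCone A
    (traceTens (extend G) hρ) hb hfeas
    (fun X hX => traceTens_extend_nonneg hρ0 hρ hG (hK.mem_posCone hX)) hneg hcore
  have hφ1 : ∀ m : Matrix (Fin d) (Fin d) ℝ, φ (m, 0) =
      ∑ i, ∑ j, φ (Matrix.single i j 1, 0) * m i j := by
    intro m
    have : φ (m, 0) = (φ ∘ₗ LinearMap.inl ℝ _ _) m := rfl
    rw [this]
    conv_lhs => rw [Matrix.matrix_eq_sum_single m]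
    rw [map_sum]
    refine Finset.sum_congr rfl fun i _ => ?_
    rw [map_sum]
    refine Finset.sum_congr rfl fun j _ => ?_
    have h1 : Matrix.single i j (m i j) = m i j • Matrix.single i j (1 : ℝ) := by
      rw [Matrix.smul_single, smul_eq_mul, mul_one]
    rw [h1, map_smul, smul_eq_mul, mul_comm]
    rfl
  have hsplit : ∀ (m : Matrix (Fin d) (Fin d) ℝ) (N : selfAdjoint (H →L[ℂ] H)),
      φ (m, N) = φ (m, 0) + (φ ∘ₗ LinearMap.inr ℝ _ _) N := by
    intro m N
    rw [LinearMap.comp_apply, LinearMap.inr_apply, ← map_add, Prod.mk_add_mk, add_zero, zero_add]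
  obtain ⟨S, hS, hS1, hSK⟩ := exists_normal_multiplier hK (G := G) hρ hD
    (Matrix.of fun i j => φ (Matrix.single i j 1, 0)) (φ ∘ₗ LinearMap.inr ℝ _ _) (by
      intro X hX
      have h := hφ X hX
      rw [show A X = (_, _) from rfl, hsplit, hφ1] at h
      exact h)
  refine ⟨(Matrix.of fun i j => φ (Matrix.single i j 1, 0), S),
    ⟨hS.1, hS.2, dualOp_mem_spaceT ?_ hρ hD hS _, hSK⟩, ?_⟩
  · have := hG.1
    rwa [Matrix.IsHermitian, Matrix.conjTranspose_eq_transpose_of_trivial] at this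
  · rw [hsplit, hφ1] at hφb
    rw [← hφb]
    refine add_le_add (le_of_eq ?_) hS1
    simp [Matrix.trace, Matrix.one_apply]

theorem strong_duality {K : Set (BlockOp d H)} (hK : IsAdmissible K)
    {G : Matrix (Fin d) (Fin d) ℝ} (hG : G.PosSemidef) {ρ : H →L[ℂ] H} (hρ0 : 0 ≤ ρ)
    (hρ : IsTraceSA ρ) {D : Fin d → H →L[ℂ] H} (hD : ∀ j, IsTraceSA (D j))
    (hli : LinearIndependent ℝ D) [Nontrivial H] :
    primalValue G ρ D K = dualValue G ρ D K ∧ primalValue G ρ D K ≠ ⊤ ∧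
      primalValue G ρ D K ≠ ⊥ := by
  have hbot : primalValue G ρ D K ≠ ⊥ := by
    have h : (0 : EReal) ≤ primalValue G ρ D K := le_iInf₂ fun X hX => by
      exact_mod_cast traceTens_extend_nonneg hρ0 hρ hG (hK.mem_posCone hX.1)
    exact ne_of_gt (lt_of_lt_of_le EReal.bot_lt_zero h)
  have htop : primalValue G ρ D K ≠ ⊤ := by
    obtain ⟨X, hX, h0, h1⟩ := exists_mem_of_constraints hK hD hli 1 (le_refl (1 : H →L[ℂ] H))
    have h : primalValue G ρ D K ≤ _ :=
      iInf₂_le X ((mem_primalFeasible_iff hK hD).2 ⟨hX, h0, h1⟩)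
    exact ne_of_lt (lt_of_le_of_lt h (EReal.coe_lt_top _))
  refine ⟨le_antisymm ?_ (weak_duality hK hρ hD), htop, hbot⟩
  -- Finiteness of the primal value allows it to serve as the real bound `v`; the dual supremum is
  -- then attained at `p`.
  obtain ⟨p, hp, hvp⟩ := exists_dual_optimal hK hG hρ0 hρ hD hli
    (v := (primalValue G ρ D K).toReal) (fun X hX => by
      rw [← EReal.coe_le_coe_iff, EReal.coe_toReal htop hbot]
      exact iInf₂_le X hX)
  rw [← EReal.coe_toReal htop hbot]
  exact le_iSup₂_of_le p hp (EReal.coe_le_coe_iff.2 hvp)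

end CRBound

end

theorem theorem4 {H : Type*} [NormedAddCommGroup H] [InnerProductSpace ℂ H] [CompleteSpace H]
    {d : ℕ} (G : Matrix (Fin d) (Fin d) ℝ) (hG : G.PosSemidef)
    (ρ : H →L[ℂ] H) (hρ : ρ.IsPositive) (hρtc : CRBound.IsTraceClass ρ)
    (hρ1 : CRBound.opTrace ρ = 1)
    (D : Fin d → H →L[ℂ] H) (hD : ∀ j, IsSelfAdjoint (D j))
    (hDtc : ∀ j, CRBound.IsTraceClass (D j)) (hDli : LinearIndependent ℝ D) (l : Fin 5) :
    CRBound.primalValue G ρ D (CRBound.cone d ρ l) = CRBound.dualValue G ρ D (CRBound.cone d ρ l) ∧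
      CRBound.primalValue G ρ D (CRBound.cone d ρ l) ≠ ⊤ ∧
      CRBound.primalValue G ρ D (CRBound.cone d ρ l) ≠ ⊥ := by
  have hρt : CRBound.IsTraceSA ρ := ⟨hρ.isSelfAdjoint, hρtc⟩
  have : Nontrivial H := by
    by_contra h
    rw [not_nontrivial_iff_subsingleton] at h
    have h0 : CRBound.opTrace ρ = 0 := by
      simp [CRBound.opTrace, Subsingleton.elim _ (0 : H)]
    exact one_ne_zero (hρ1.symm.trans h0)
  exact CRBound.strong_duality (CRBound.isAdmissible_cone hρt hρ1 l) hG
    ((ContinuousLinearMap.nonneg_iff_isPositive ρ).2 hρ) hρt (fun j => ⟨hD j, hDtc j⟩) hDli
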